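/- **Corollary (Linear Code Formulation).** Let $q=p^e$ be a prime power, $\bar x=x^q$ on $\mathbb F_{q^2}$, $(\mathbf u,\mathbf v)_h=\sum_j u_j\bar v_j$, and for a linear code $\mathcal D\subseteq\mathbb F_{q^2}^n$ let $\mathcal D^{\perp_h}$ be its Hermitian dual and $R_h(\mathcal D)=\mathcal D\cap\mathcal D^{\perp_h}$ its Hermitian radical; $\mathcal D$ is Hermitian LCD if $R_h(\mathcal D)=0$, and Hermitian self-orthogonal if $\mathcal D\subseteq\mathcal D^{\perp_h}$. *Quantum notions.* On $(\mathbb C^q)^{\otimes N}$ with orthonormal basis $|j\rangle$, $j\in\mathbb F_q^N$, put $X(\mathbf a)|j\rangle=|j+\mathbf a\rangle$ and $Z(\mathbf b)|j\rangle=e^{2\pi i\,\mathrm{tr}(\mathbf b\cdot j)/p}|j\rangle$, where $\mathrm{tr}:\mathbb F_q\to\mathbb F_p$ is the absolute trace. Let $\mathcal E_N$ be the group of all $\zeta^iX(\mathbf a)Z(\mathbf b)$, where $\zeta=e^{2\pi i/p}$ if $p$ is odd and $\zeta=\sqrt{-1}$ if $p=2$. For a subgroup $\mathcal S\le\mathcal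 E_N$ let $\tau(\mathcal S)\subseteq\mathbb F_q^{2N}$ be the set of all $(\mathbf a|\mathbf b)$ such that $\zeta^iX(\mathbf a)Z(\mathbf b)\in\mathcal S$ for some $i$. An Abelian subgroup $\mathcal S\le\mathcal E_m$ without scalars other than $I$ *stabilizes* an $[[m,k]]_q$ code $\mathcal Q$ if $\mathcal Q$ is the space of vectors fixed by $\mathcal S$ and $\dim\mathcal Q=q^k$. An $[[n,k,d;c]]_q$ EAQECC is a subspace $\mathcal Q$ of the space of $n$ qudits of Alice and $c$ qudits of Bob of the form $\{(V\otimes I_B)(\psi\otimes\Phi):\psi\in(\mathbb C^q)^{\otimes k}\}$, where $\Phi$ is the state of $c$ maximally entangled pairs and $V$ is an isometry from the $k$ information qudits and Alice's halves of the pairs to her $n$ qudits; $d$ is the least weight of a Pauli operator $E$ on Alice's qudits such that $E\otimes I_B$ is not detected by $\mathcal Q$ in the sense of Knill and Laflamme ($d=\infty$ if there is none). A subgroup $\mathcal S\le\mathcal E_n$ *EA-stabilizes* $\mathcal Q$ if there is an Abelian subgroup $\tilde{\mathcal S}\le\mathcal E_{n+c}$ without scalars other than $I$ whose fixed space is $\mathcal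 Q$ and such that restriction to Alice's coordinates is a bijection $\tau(\tilde{\mathcal S})\to\tau(\mathcal S)$. A *combination EAQECC-Ne* $[[n,k,d;c]]_q+[[m,k_b]]_q$ consists of a subgroup $\mathcal S\le\mathcal E_n$ that EA-stabilizes an $[[n,k,d;c]]_q$ EAQECC and an Abelian subgroup $\mathcal S^b\le\mathcal E_m$ that stabilizes an $[[m,k_b]]_q$ code $\mathcal Q^b$ with $k_b\ge c$, so that Bob's $c$ qudits can be encoded isometrically into $\mathcal Q^b$. *Statement.* Let $\mathcal D=[n,u]_{q^2}$ be a linear code with $\mathcal D=R_h(\mathcal D)\oplus\mathcal D_e$, where $\mathcal D_e$ is Hermitian LCD and $\dim R_h(\mathcal D)=r$. Let $\mathcal D^b=[m,v]_{q^2}$ be a Hermitian self-orthogonal code with $c=u-r\le k_b=m-2v$. Then there is a combination EAQECC-Ne $$[[n,\;n-c-2r,\;d_{ea};\;c]]_q+[[m,\;m-2v]]_q,\qquad d_{ea}=\min\{\mathrm{wt}(x):x\in\mathcal D^{\perp_h}\setminus R_h(\mathcal D)\}$$ (with $\min\emptyset=\infty$). More precisely, there exist $\beta\in\mathbb F_{q^2}$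 such that $\{\beta,\beta^q\}$ is a basis of $\mathbb F_{q^2}$ over $\mathbb F_q$, and for each such $\beta$, with $\phi(\mathbf a|\mathbf b)=\beta\mathbf a+\beta^q\mathbf b$, the groups can be chosen with $\tau(\mathcal S)=\phi^{-1}(\mathcal D)$ and $\tau(\mathcal S^b)=\phi^{-1}(\mathcal D^b)$. -/

import Mathlib

open scoped Matrix

namespace EAQ

/-! ### Linear codes over the quadratic extension `K` of `F`, with the Hermitian form -/

section Codes

variable (F : Type*) [Fintype F] {K : Type*} [Field K] {ι : Type*} [Fintype ι]

/-- The Hermitian inner product `∑ j, u j * (v j) ^ q`, where `q = |F|`. -/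
def hermForm (u v : ι → K) : K := ∑ j, u j * v j ^ Fintype.card F

/-- The Hermitian dual code. -/
def hermDual (D : Submodule K (ι → K)) : Submodule K (ι → K) where
  carrier := {u | ∀ v ∈ D, hermForm F u v = 0}
  add_mem' := by
    intro a b ha hb v hv
    have h1 := ha v hv
    have h2 := hb v hv
    simp only [hermForm] at h1 h2 ⊢
    simp [add_mul, Finset.sum_add_distrib, h1, h2]
  zero_mem' := by
    intro v _
    simp [hermForm]
  smul_mem' := by
    intro t a ha v hv
    have h1 := ha v hv
    simp only [hermForm] at h1 ⊢
    simp [mul_assoc, ← Finset.mul_sum, h1]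

/-- The Hermitian radical `D ∩ D^{⊥h}`. -/
def hermRadical (D : Submodule K (ι → K)) : Submodule K (ι → K) := D ⊓ hermDual F D

/-- Hermitian LCD codes: the Hermitian radical is zero. -/
def IsHermLCD (D : Submodule K (ι → K)) : Prop := hermRadical F D = ⊥

/-- Hermitian self-orthogonal codes. -/
def IsHermSelfOrthogonal (D : Submodule K (ι → K)) : Prop := D ≤ hermDual F D

/-- Smallest Hamming weight of a vector of `A`, as an element of `ℕ∞` (`⊤` if `A` is empty). -/
noncomputable def minWeight [DecidableEq K] (A : Set (ι → K)) : ℕ∞ :=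
  ⨅ x ∈ A, (hammingNorm x : ℕ∞)

end Codes

section Isometry

variable (F : Type*) [Field F] [Fintype F] {K : Type*} [Field K] [Algebra F K] {ι : Type*}

/-- `{β, β^q}` is a basis of `K` over `F`. -/
def IsNormalBasis (β : K) : Prop :=
  LinearIndependent F ![β, β ^ Fintype.card F] ∧
    Submodule.span F {β, β ^ Fintype.card F} = ⊤

/-- The map `φ(a|b) = β a + β^q b` from `F^{2n}` to `K^n`. -/
def phi (β : K) (v : (ι → F) × (ι → F)) : ι → K := fun j =>
  β * algebraMap F K (v.1 j) + β ^ Fintype.card F * algebraMap F K (v.2 j)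

end Isometry

/-! ### Generalized Pauli operators

The space of the qudits indexed by `ι` is `(ι → F) → ℂ`, with orthonormal basis
`|j⟩`, `j ∈ F^ι`, and inner product `star x ⬝ᵥ y`. -/

section Pauli

variable (F : Type*) [Field F] [Fintype F]

theorem ringChar_neZero : NeZero (ringChar F) :=
  ⟨(CharP.char_is_prime F (ringChar F)).ne_zero⟩

/-- The additive character `x ↦ ω ^ tr x` of `F`, where `tr : F → 𝔽_p` is the absolute trace and
`ω = exp (2 π i / p)`. -/
noncomputable def traceChar : AddChar F ℂ :=
  letI := ZMod.algebra F (ringChar F)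
  haveI := ringChar_neZero F
  (ZMod.stdAddChar (N := ringChar F)).compAddMonoidHom
    (Algebra.trace (ZMod (ringChar F)) F).toAddMonoidHom

/-- The order of the group of phases: `p` if `p` is odd, and `4` if `p = 2`. -/
noncomputable def phaseOrder : ℕ := if ringChar F = 2 then 4 else ringChar F

/-- The generating phase: `ω = exp (2 π i / p)` if `p` is odd, and `i` if `p = 2`. -/
noncomputable def phase : ℂ := Complex.exp (2 * Real.pi * Complex.I / phaseOrder F)

theorem traceChar_eq_phase_pow (x : F) : ∃ i : ℕ, traceChar F x = phase F ^ i := by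
  let := ZMod.algebra F (ringChar F)
  have := ringChar_neZero F
  set t : ZMod (ringChar F) := Algebra.trace (ZMod (ringChar F)) F x with ht
  have h : traceChar F x = ZMod.stdAddChar t := rfl
  have hp : ((ringChar F : ℕ) : ℂ) ≠ 0 := Nat.cast_ne_zero.2 (NeZero.ne _)
  have h2 : traceChar F x = Complex.exp (2 * Real.pi * Complex.I * t.val / ringChar F) := by
    rw [h]
    conv_lhs => rw [← ZMod.natCast_zmod_val t]
    have := ZMod.stdAddChar_coe (N := ringChar F) (t.val : ℤ)
    simpa using this
  by_cases hc : ringChar F = 2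
  · refine ⟨2 * t.val, ?_⟩
    rw [h2, phase, ← Complex.exp_nat_mul]
    congr 1
    have h4 : phaseOrder F = 4 := if_pos hc
    have h5 : ((ringChar F : ℕ) : ℂ) = 2 := by rw [hc]; norm_num
    rw [h4, h5]
    push_cast
    ring
  · refine ⟨t.val, ?_⟩
    rw [h2, phase, ← Complex.exp_nat_mul]
    congr 1
    have h4 : phaseOrder F = ringChar F := if_neg hc
    rw [h4]
    ring

theorem phase_pow_phaseOrder : phase F ^ phaseOrder F = 1 := by
  have h0 : phaseOrder F ≠ 0 := by
    unfold phaseOrder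
    split_ifs
    · norm_num
    · exact (ringChar_neZero F).ne
  rw [phase, ← Complex.exp_nat_mul, mul_div_cancel₀ _ (Nat.cast_ne_zero.2 h0)]
  exact Complex.exp_two_pi_mul_I

theorem phaseOrder_pos : 0 < phaseOrder F := by
  unfold phaseOrder
  split_ifs
  · norm_num
  · exact Nat.pos_of_ne_zero (ringChar_neZero F).ne

variable {F} [DecidableEq F] {ι : Type*} [Fintype ι] [DecidableEq ι]

/-- `X(a)|j⟩ = |j + a⟩`. -/
def pauliX (a : ι → F) : Matrix (ι → F) (ι → F) ℂ :=
  Matrix.of fun i j => if i = j + a then 1 else 0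

/-- `Z(b)|j⟩ = ω ^ tr (b ⬝ j) |j⟩`. -/
noncomputable def pauliZ (b : ι → F) : Matrix (ι → F) (ι → F) ℂ :=
  Matrix.diagonal fun j => traceChar F (b ⬝ᵥ j)

/-- The operator `X(a) Z(b)`. -/
noncomputable def pauli (v : (ι → F) × (ι → F)) : Matrix (ι → F) (ι → F) ℂ :=
  pauliX v.1 * pauliZ v.2

theorem pauli_apply (v : (ι → F) × (ι → F)) (i j : ι → F) :
    pauli v i j = if i = j + v.1 then traceChar F (v.2 ⬝ᵥ j) else 0 := by
  simp [pauli, pauliX, pauliZ, Matrix.mul_diagonal]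

theorem pauli_mul (v w : (ι → F) × (ι → F)) :
    pauli v * pauli w = traceChar F (v.2 ⬝ᵥ w.1) • pauli (v + w) := by
  ext i j
  rw [Matrix.mul_apply, Finset.sum_eq_single (j + w.1)]
  · simp only [pauli_apply, Matrix.smul_apply, smul_eq_mul, Prod.fst_add, Prod.snd_add, if_true]
    have h : (i = j + w.1 + v.1) ↔ (i = j + (v.1 + w.1)) := by
      rw [add_assoc, add_comm w.1]
    by_cases hi : i = j + w.1 + v.1
    · rw [if_pos hi, if_pos (h.1 hi), ← AddChar.map_add_eq_mul, ← AddChar.map_add_eq_mul]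
      congr 1
      rw [dotProduct_add, add_dotProduct]
      ring
    · rw [if_neg hi, if_neg (fun h' => hi (h.2 h'))]
      simp
  · intro k _ hk
    rw [pauli_apply w, if_neg hk, mul_zero]
  · simp

theorem pauli_zero : pauli (0 : (ι → F) × (ι → F)) = 1 := by
  ext i j
  simp [pauli_apply, Matrix.one_apply]

/-- The Pauli group `{ζ ^ i X(a) Z(b)}` on the qudits indexed by `ι`, where `ζ = phase F`. -/
noncomputable def pauliGroup (F : Type*) [Field F] [Fintype F] [DecidableEq F]
    (ι : Type*) [Fintype ι] [DecidableEq ι] :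
    Subgroup (Matrix.unitaryGroup (ι → F) ℂ) where
  carrier := {g | ∃ (i : ℕ) (v : (ι → F) × (ι → F)),
    (g : Matrix (ι → F) (ι → F) ℂ) = phase F ^ i • pauli v}
  one_mem' := ⟨0, 0, by simp [pauli_zero]⟩
  mul_mem' := by
    rintro g h ⟨i, v, hg⟩ ⟨j, w, hh⟩
    obtain ⟨l, hl⟩ := traceChar_eq_phase_pow F (v.2 ⬝ᵥ w.1)
    refine ⟨i + j + l, v + w, ?_⟩
    rw [Matrix.UnitaryGroup.mul_val, hg, hh, Matrix.smul_mul, Matrix.mul_smul, pauli_mul, hl,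
      smul_smul, smul_smul, pow_add, pow_add, mul_assoc]
  inv_mem' := by
    rintro g ⟨i, v, hg⟩
    obtain ⟨l, hl⟩ := traceChar_eq_phase_pow F (v.2 ⬝ᵥ (-v).1)
    -- an inverse of `phase F ^ (i + l)`
    have hinv : phase F ^ ((i + l) * (phaseOrder F - 1)) * phase F ^ (i + l) = 1 := by
      rw [← pow_add]
      have h1 : (i + l) * (phaseOrder F - 1) + (i + l) = phaseOrder F * (i + l) := by
        obtain ⟨n, hn⟩ := Nat.exists_eq_succ_of_ne_zero (phaseOrder_pos F).ne'
        rw [hn]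
        simp
        ring
      rw [h1, pow_mul, phase_pow_phaseOrder, one_pow]
    refine ⟨(i + l) * (phaseOrder F - 1), -v, ?_⟩
    have hmul : (g : Matrix (ι → F) (ι → F) ℂ) *
        (phase F ^ ((i + l) * (phaseOrder F - 1)) • pauli (-v)) = 1 := by
      rw [hg, Matrix.smul_mul, Matrix.mul_smul, pauli_mul, hl, smul_smul, smul_smul,
        add_neg_cancel, pauli_zero]
      have h2 : phase F ^ i * (phase F ^ ((i + l) * (phaseOrder F - 1)) * phase F ^ l) = 1 := by
        rw [← hinv, pow_add (phase F) i l]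
        ring
      rw [mul_assoc, h2, one_smul]
    have hg1 : ((g⁻¹ : Matrix.unitaryGroup (ι → F) ℂ) : Matrix (ι → F) (ι → F) ℂ) *
        (g : Matrix (ι → F) (ι → F) ℂ) = 1 := by
      rw [← Matrix.UnitaryGroup.mul_val, inv_mul_cancel, Matrix.UnitaryGroup.one_val]
    exact left_inv_eq_right_inv hg1 hmul

/-- The map `τ`: the set of all `(a|b)` such that some `ζ ^ i X(a) Z(b)` lies in `S`. -/
def pauliVectors (S : Subgroup (Matrix.unitaryGroup (ι → F) ℂ)) : Set ((ι → F) × (ι → F)) :=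
  {v | ∃ g ∈ S, ∃ i : ℕ, (g : Matrix (ι → F) (ι → F) ℂ) = phase F ^ i • pauli v}

/-- The number of coordinates on which `X(a) Z(b)` acts nontrivially. -/
def pauliWeight (v : (ι → F) × (ι → F)) : ℕ :=
  (Finset.univ.filter fun j => v.1 j ≠ 0 ∨ v.2 j ≠ 0).card

/-! ### Quantum codes -/

/-- An Abelian subgroup of the Pauli group that contains no scalar other than the identity. -/
structure IsStabilizerGroup (S : Subgroup (Matrix.unitaryGroup (ι → F) ℂ)) : Prop where
  le_pauli : S ≤ pauliGroup F ι
  comm : ∀ g ∈ S, ∀ h ∈ S, g * h = h * g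
  no_scalar : ∀ g ∈ S, ∀ z : ℂ,
    (g : Matrix (ι → F) (ι → F) ℂ) = z • (1 : Matrix (ι → F) (ι → F) ℂ) → g = 1

/-- The space of vectors fixed by all elements of `S`. -/
def fixedSpace (S : Subgroup (Matrix.unitaryGroup (ι → F) ℂ)) :
    Submodule ℂ ((ι → F) → ℂ) where
  carrier := {x | ∀ g ∈ S, (g : Matrix (ι → F) (ι → F) ℂ) *ᵥ x = x}
  add_mem' := by
    intro x y hx hy g hg
    rw [Matrix.mulVec_add, hx g hg, hy g hg]
  zero_mem' := by
    intro g _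
    simp
  smul_mem' := by
    intro t x hx g hg
    rw [Matrix.mulVec_smul, hx g hg]

/-- The Knill-Laflamme condition: the code `Q` detects the error `E`. -/
def Detects (Q : Submodule ℂ ((ι → F) → ℂ)) (E : Matrix (ι → F) (ι → F) ℂ) : Prop :=
  ∃ z : ℂ, ∀ x ∈ Q, ∀ y ∈ Q, star x ⬝ᵥ (E *ᵥ y) = z * (star x ⬝ᵥ y)

/-- `S` stabilizes the `[[m, k]]_q` code `Q`. -/
structure Stabilizes {m : ℕ} (S : Subgroup (Matrix.unitaryGroup (Fin m → F) ℂ)) (k : ℕ)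
    (Q : Submodule ℂ ((Fin m → F) → ℂ)) : Prop where
  group : IsStabilizerGroup S
  code : Q = fixedSpace S
  dim : Module.finrank ℂ Q = Fintype.card F ^ k

/-! ### Entanglement-assisted codes

Alice holds the qudits indexed by `Fin n`, Bob those indexed by `Fin c`. -/

variable (F) in
/-- The state `q ^ (-c/2) ∑ z, |z⟩|z⟩` of `c` maximally entangled pairs. -/
noncomputable def maxEntangled {c : ℕ} (z y : Fin c → F) : ℂ :=
  if z = y then ((Real.sqrt ((Fintype.card F : ℝ) ^ c))⁻¹ : ℝ) else 0

/-- The matrix of `x ↦ (V ⊗ I_B) (x ⊗ Φ)`, where `Φ` is the state of `c` maximally entangled pairs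
and `V` maps the `k` information qudits and Alice's halves of the pairs to her `n` qudits. -/
noncomputable def eaEncoder {n k c : ℕ}
    (V : Matrix (Fin n → F) ((Fin k → F) × (Fin c → F)) ℂ) :
    Matrix (Fin n ⊕ Fin c → F) (Fin k → F) ℂ :=
  Matrix.of fun y j => ∑ z : Fin c → F, V (y ∘ Sum.inl) (j, z) * maxEntangled F z (y ∘ Sum.inr)

/-- The Pauli error `X(a) Z(b) ⊗ I_B` on Alice's qudits. -/
noncomputable def aliceError {n c : ℕ} (v : (Fin n → F) × (Fin n → F)) :
    Matrix (Fin n ⊕ Fin c → F) (Fin n ⊕ Fin c → F) ℂ :=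
  pauli (Sum.elim v.1 0, Sum.elim v.2 0)

/-- The distance of an entanglement-assisted code: the smallest weight of a Pauli error on Alice's
qudits that is not detected (`⊤` if there is none). -/
noncomputable def eaDistance {n c : ℕ} (Q : Submodule ℂ ((Fin n ⊕ Fin c → F) → ℂ)) : ℕ∞ :=
  ⨅ v : (Fin n → F) × (Fin n → F), ⨅ _ : ¬ Detects Q (aliceError v), (pauliWeight v : ℕ∞)

/-- `Q` is an `[[n, k, d; c]]_q` code: it consists of the states that Alice obtains when she encodes
`k` qudits and her halves of `c` maximally entangled pairs into `n` qudits by an isometry, and it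
has distance `d`. -/
structure IsEAQECC (n k : ℕ) (d : ℕ∞) (c : ℕ)
    (Q : Submodule ℂ ((Fin n ⊕ Fin c → F) → ℂ)) : Prop where
  encoder : ∃ V : Matrix (Fin n → F) ((Fin k → F) × (Fin c → F)) ℂ,
    Vᴴ * V = 1 ∧ Q = LinearMap.range (eaEncoder V).mulVecLin
  distance : eaDistance Q = d

/-- Alice's part of a vector `(a|b)` on the qudits of Alice and Bob. -/
def alicePart {n c : ℕ} (w : (Fin n ⊕ Fin c → F) × (Fin n ⊕ Fin c → F)) :
    (Fin n → F) × (Fin n → F) :=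
  (w.1 ∘ Sum.inl, w.2 ∘ Sum.inl)

/-- `T` extends `S` by operators on Bob's `c` qudits: up to phases, taking Alice's part is a
bijection from `T` to `S`. -/
def IsExtension {n c : ℕ} (S : Subgroup (Matrix.unitaryGroup (Fin n → F) ℂ))
    (T : Subgroup (Matrix.unitaryGroup (Fin n ⊕ Fin c → F) ℂ)) : Prop :=
  Set.BijOn alicePart (pauliVectors T) (pauliVectors S)

/-- `S` is the EA-stabilizer of the `[[n, k, d; c]]_q` code `Q`: it is a (not necessarily Abelian)
subgroup of Alice's Pauli group, it extends to an Abelian group `T` on the qudits of Alice and Bob,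
and `T` stabilizes `Q`. -/
structure EAStabilizes {n c : ℕ} (S : Subgroup (Matrix.unitaryGroup (Fin n → F) ℂ))
    (k : ℕ) (d : ℕ∞) (Q : Submodule ℂ ((Fin n ⊕ Fin c → F) → ℂ)) : Prop where
  le_pauli : S ≤ pauliGroup F (Fin n)
  extension : ∃ T : Subgroup (Matrix.unitaryGroup (Fin n ⊕ Fin c → F) ℂ),
    IsStabilizerGroup T ∧ IsExtension S T ∧ Q = fixedSpace T
  code : IsEAQECC n k d c Q

/-- `S` and `Sb` form a matching pair and define a combination EAQECC-Ne
`Qea + Qb = [[n, k, d; c]]_q + [[m, kb]]_q`: `S` EA-stabilizes `Qea`, `Sb` stabilizes `Qb`,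
`c ≤ kb`, and Bob's halves of the `c` pairs can be encoded into `Qb` by an isometry `W`. -/
structure IsCombination {n m c : ℕ} (S : Subgroup (Matrix.unitaryGroup (Fin n → F) ℂ))
    (Sb : Subgroup (Matrix.unitaryGroup (Fin m → F) ℂ)) (k : ℕ) (d : ℕ∞) (kb : ℕ)
    (Qea : Submodule ℂ ((Fin n ⊕ Fin c → F) → ℂ)) (Qb : Submodule ℂ ((Fin m → F) → ℂ)) :
    Prop where
  alice : EAStabilizes S k d Qea
  bob : Stabilizes Sb kb Qb
  le : c ≤ kb
  encode : ∃ W : Matrix (Fin m → F) (Fin c → F) ℂ, Wᴴ * W = 1 ∧ ∀ x, W *ᵥ x ∈ Qb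

end Pauli

end EAQ

namespace EAQ

/-! ### Alternating forms in Darboux coordinates -/

section Darboux

variable {F : Type*} [Field F] {ι κ : Type*} [Fintype ι] [Fintype κ]

/-! The map `phi` turns Hermitian duality over `K` into symplectic duality over `F`
(`IsNormalBasis.phi_mem_hermDual_iff`), and the symplectic form governs commutation of Pauli
operators through the trace character. Hence `C = φ⁻¹(D)` has radical `φ⁻¹(R_h(D))`, and Darboux
coordinates modulo this radical give a surjection `f : C → F^{2c}` that pulls the standard form back
to the form of `C` (`exists_hyperbolic_coordinates`). Appending `f x` on Bob's side with its halves
interchanged contributes the negative of that form, so the extended space is isotropic.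

An isotropic space lifts to a stabilizer group (`exists_isStabilizerGroup`): all its Pauli operators
form an Abelian group, and the kernel of a character extending the tautological one on scalars
contains no scalar but the identity, yet still realizes every vector. The trace of the projection
onto the fixed space gives the dimension `q^(n+c-2u)`.

Since `f` is surjective, every nontrivial Pauli operator on Bob's qudits fails to commute with the
group. Fourier inversion then shows that Bob's share of each code state is maximally mixed, so
rescaled slices of an orthonormal basis form Alice's isometry (`exists_eaEncoder`). An error of
Alice is undetected exactly when it lies in the symplectic dual of `C` but not in `C`
(`detects_aliceError_iff`); as `phi` preserves weights, this is the asserted distance. Bob's own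
code is the same lift applied to the isotropic space `φ⁻¹(Db)`. -/

variable (F ι) in
/-- The standard symplectic form `(a|b), (a'|b') ↦ a ⬝ b' - b ⬝ a'` on `F^{2ι}`. -/
def sympForm : ((ι → F) × (ι → F)) →ₗ[F] ((ι → F) × (ι → F)) →ₗ[F] F :=
  LinearMap.mk₂ F (fun v w => v.1 ⬝ᵥ w.2 - v.2 ⬝ᵥ w.1)
    (fun v v' w => by simp only [Prod.fst_add, Prod.snd_add, add_dotProduct]; ring)
    (fun t v w => by simp only [Prod.smul_fst, Prod.smul_snd, smul_dotProduct, smul_sub])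
    (fun v w w' => by simp only [Prod.fst_add, Prod.snd_add, dotProduct_add]; ring)
    (fun t v w => by simp only [Prod.smul_fst, Prod.smul_snd, dotProduct_smul, smul_sub])

theorem sympForm_apply (v w : (ι → F) × (ι → F)) :
    sympForm F ι v w = v.1 ⬝ᵥ w.2 - v.2 ⬝ᵥ w.1 := rfl

/-- The sign is the reason why `extendBy` interchanges the halves: Bob's contribution then cancels
Alice's. -/
theorem sympForm_swap_swap (v w : (ι → F) × (ι → F)) :
    sympForm F ι v.swap w.swap = -sympForm F ι v w := by
  simp [sympForm_apply]

theorem sympForm_isAlt : (sympForm F ι).IsAlt := fun v => by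
  simp [sympForm_apply, dotProduct_comm v.1 v.2]

theorem eq_zero_of_forall_sympForm_eq_zero {v : (ι → F) × (ι → F)}
    (h : ∀ w, sympForm F ι v w = 0) : v = 0 := by
  classical
  ext i
  · simpa [sympForm_apply] using h (0, Pi.single i 1)
  · simpa [sympForm_apply] using h (Pi.single i 1, 0)

/-- An alternating form on a finite-dimensional space is the pullback of a standard symplectic form
along a surjective linear map. -/
theorem exists_surjective_eq_sympForm {V : Type*} [AddCommGroup V] [Module F V]
    [FiniteDimensional F V] (ω : V →ₗ[F] V →ₗ[F] F) (hω : ω.IsAlt) :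
    ∃ (c : ℕ) (f : V →ₗ[F] (Fin c → F) × (Fin c → F)), Function.Surjective f ∧
      ∀ x y, ω x y = sympForm F (Fin c) (f x) (f y) := by
  -- Splitting off a hyperbolic plane enlarges the kernel, so the induction ascends along kernels.
  induction hk : LinearMap.ker ω using WellFoundedGT.induction generalizing ω with
  | ind k ih =>
  by_cases h0 : ω = 0
  · refine ⟨0, 0, fun y => ⟨0, Subsingleton.elim _ _⟩, fun x y => ?_⟩
    simp [h0]
  obtain ⟨e, g, heg⟩ : ∃ e g, ω e g = 1 := by
    by_contra! hne
    apply h0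
    ext x y
    by_contra hxy
    exact hne x ((ω x y)⁻¹ • y) (by simpa using inv_mul_cancel₀ hxy)
  have hge : ω g e = -1 := by rw [← hω.neg, heg]
  -- Subtract the part of `ω` carried by the hyperbolic plane of `e` and `g`: both vectors fall into
  -- the kernel, and nothing changes on their orthogonal complement.
  let ω' : V →ₗ[F] V →ₗ[F] F :=
    ω - ((ω.flip g).smulRight (ω e) - (ω e).smulRight (ω.flip g))
  have hω'_apply (x y : V) : ω' x y = ω x y - (ω x g * ω e y - ω e x * ω y g) := by
    simp [ω']
  have hω' : ω'.IsAlt := fun x => by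
    rw [hω'_apply, hω x]; ring
  have he : ω' e = 0 := by
    ext y
    simp [hω'_apply, heg, hω e]
  have hg : ω' g = 0 := by
    ext y
    simp [hω'_apply, heg, hω g, ← hω.neg y g]
  -- The kernel grows strictly because `e` lies in the new one but not in the old one.
  obtain ⟨c, f, hf, hfω⟩ := ih (LinearMap.ker ω') (by
    subst hk
    refine lt_of_le_of_ne (fun x hx => ?_) fun heq => ?_
    · rw [LinearMap.mem_ker] at hx ⊢
      ext y
      have h1 : ω e x = 0 := by rw [← hω.neg, hx]; simp
      simp [hω'_apply, hx, h1]
    · have : e ∈ LinearMap.ker ω := heq ▸ (LinearMap.mem_ker.2 he)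
      rw [LinearMap.mem_ker] at this
      simp [this] at heg) ω' hω' rfl
  have hker {x : V} (hx : ω' x = 0) : f x = 0 := by
    apply eq_zero_of_forall_sympForm_eq_zero
    intro w
    obtain ⟨y, rfl⟩ := hf w
    rw [← hfω, hx]
    rfl
  have hfe := hker he
  have hfg := hker hg
  -- The new coordinate pair takes the values `(1, 0)` at `e` and `(0, 1)` at `g`, and its
  -- symplectic form is the part subtracted in `ω'`. Since `f` kills `e` and `g`, the new pair can
  -- be adjusted without disturbing the old ones.
  refine ⟨c + 1,
    { toFun := fun x => (Matrix.vecCons (ω x g) (f x).1, Matrix.vecCons (ω e x) (f x).2)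
      map_add' := fun x y => by simp
      map_smul' := fun t x => by simp }, fun p => ?_, fun x y => ?_⟩
  · obtain ⟨x, hx⟩ := hf (Matrix.vecTail p.1, Matrix.vecTail p.2)
    refine ⟨x + (p.1 0 - ω x g) • e + (p.2 0 - ω e x) • g, ?_⟩
    ext i
    · cases i using Fin.cases with
      | zero => simp [heg, hω g]
      | succ i => simp [hfe, hfg, hx, Matrix.vecTail]
    · cases i using Fin.cases with
      | zero => simp [heg, hω e]
      | succ i => simp [hfe, hfg, hx, Matrix.vecTail]
  · have := hfω x y
    rw [hω'_apply, sympForm_apply] at this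
    rw [sympForm_apply]
    simp only [LinearMap.coe_mk, AddHom.coe_mk, Matrix.cons_dotProduct_cons]
    linear_combination this

theorem sympForm_sumElim (a b a' b' : ι → F) (x y x' y' : κ → F) :
    sympForm F (ι ⊕ κ) (Sum.elim a x, Sum.elim b y) (Sum.elim a' x', Sum.elim b' y') =
      sympForm F ι (a, b) (a', b') + sympForm F κ (x, y) (x', y') := by
  simp only [sympForm_apply, sumElim_dotProduct_sumElim]
  ring

/-- The extension of `(a|b)` by the symplectic coordinates `f (a|b)`, with the two halves of the
latter interchanged. -/
def extendBy {C : Submodule F ((ι → F) × (ι → F))} (f : C →ₗ[F] (κ → F) × (κ → F)) :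
    C →ₗ[F] (ι ⊕ κ → F) × (ι ⊕ κ → F) where
  toFun x := (Sum.elim x.1.1 (f x).2, Sum.elim x.1.2 (f x).1)
  map_add' x y := by
    ext (i | i) <;> simp
  map_smul' t x := by
    ext (i | i) <;> simp

/-- Three choices of `(v, p)` matter: another extended vector for isotropy, `p = 0` for errors of
Alice, and `v = 0` for operators of Bob. -/
theorem sympForm_extendBy {C : Submodule F ((ι → F) × (ι → F))}
    (f : C →ₗ[F] (κ → F) × (κ → F)) (x : C) (v : (ι → F) × (ι → F)) (p : (κ → F) × (κ → F)) :
    sympForm F (ι ⊕ κ) (extendBy f x) (Sum.elim v.1 p.1, Sum.elim v.2 p.2) =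
      sympForm F ι x v + sympForm F κ (f x).swap p :=
  sympForm_sumElim ..

end Darboux

/-! ### Phases and the trace character -/

section Phase

variable (F : Type*) [Field F] [Fintype F]

theorem isPrimitiveRoot_phase : IsPrimitiveRoot (phase F) (phaseOrder F) :=
  Complex.isPrimitiveRoot_exp _ (phaseOrder_pos F).ne'

omit [Fintype F] in
theorem phase_ne_zero : phase F ≠ 0 := Complex.exp_ne_zero _

theorem star_phase_mul_phase (i : ℕ) : star (phase F ^ i) * phase F ^ i = 1 := by
  have h : ‖phase F‖ = 1 :=
    Complex.norm_eq_one_of_pow_eq_one (phase_pow_phaseOrder F) (phaseOrder_pos F).ne'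
  have h2 : star (phase F) * phase F = 1 := by
    rw [mul_comm]
    simp [Complex.mul_conj, Complex.normSq_eq_norm_sq, h]
  rw [star_pow, ← mul_pow, h2, one_pow]

theorem exists_phase_pow_mul_eq_one (i : ℕ) : ∃ j, phase F ^ j * phase F ^ i = 1 := by
  refine ⟨i * (phaseOrder F - 1), ?_⟩
  have h1 : i * (phaseOrder F - 1) + i = phaseOrder F * i := by
    obtain ⟨n, hn⟩ := Nat.exists_eq_succ_of_ne_zero (phaseOrder_pos F).ne'
    rw [hn]
    simp
    ring
  rw [← pow_add, h1, pow_mul, phase_pow_phaseOrder, one_pow]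

omit [Fintype F] in
theorem cast_phaseOrder_eq_zero : (phaseOrder F : F) = 0 := by
  unfold phaseOrder
  split_ifs with h
  · have h2 : ((2 : ℕ) : F) = 0 := h ▸ ringChar.Nat.cast_ringChar
    rw [show 4 = 2 * 2 from rfl, Nat.cast_mul, h2, zero_mul]
  · exact ringChar.Nat.cast_ringChar

/-- This is where characteristic 2 needs fourth roots of unity: `2.choose 2 = 1` is odd, but
`4.choose 2 = 6` is even. An odd `p` divides `p.choose 2`. -/
theorem cast_choose_phaseOrder_eq_zero : ((phaseOrder F).choose 2 : F) = 0 := by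
  rw [ringChar.spec]
  have hp := CharP.char_is_prime F (ringChar F)
  unfold phaseOrder
  split_ifs with h
  · rw [h]; decide
  · exact hp.dvd_choose_self two_ne_zero (lt_of_le_of_ne hp.two_le (Ne.symm h))

variable {F}

theorem star_traceChar (x : F) : star (traceChar F x) = traceChar F (-x) :=
  (AddChar.map_neg_eq_conj _ _).symm

theorem star_traceChar_mul_traceChar (x : F) : star (traceChar F x) * traceChar F x = 1 := by
  rw [star_traceChar, ← AddChar.map_add_eq_mul, neg_add_cancel, AddChar.map_zero_eq_one]

theorem traceChar_ne_zero (x : F) : traceChar F x ≠ 0 :=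
  fun h => by simpa [h] using star_traceChar_mul_traceChar x

/-- The trace character is primitive. -/
theorem exists_traceChar_mul_ne_one {x : F} (hx : x ≠ 0) : ∃ t, traceChar F (x * t) ≠ 1 := by
  let := ZMod.algebra F (ringChar F)
  have := ringChar_neZero F
  obtain ⟨t, ht⟩ := FiniteField.trace_to_zmod_nondegenerate F hx
  refine ⟨t, fun h => ht ?_⟩
  apply ZMod.injective_stdAddChar (N := ringChar F)
  rw [AddChar.map_zero_eq_one]
  exact h

theorem eq_zero_of_forall_traceChar_dotProduct {ι : Type*} [Fintype ι] {b : ι → F}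
    (h : ∀ j, traceChar F (b ⬝ᵥ j) = 1) : b = 0 := by
  classical
  funext i
  by_contra hi
  obtain ⟨t, ht⟩ := exists_traceChar_mul_ne_one hi
  exact ht (by simpa using h (Pi.single i t))

theorem sum_traceChar_dotProduct {ι : Type*} [Fintype ι] [DecidableEq ι] [DecidableEq F]
    (b : ι → F) :
    ∑ j, traceChar F (b ⬝ᵥ j) = if b = 0 then (Fintype.card F : ℂ) ^ Fintype.card ι else 0 := by
  classical
  let ψ : AddChar (ι → F) ℂ :=
    (traceChar F).compAddMonoidHom (dotProductBilin F F b).toAddMonoidHom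
  have hψ : ∀ j, ψ j = traceChar F (b ⬝ᵥ j) := fun _ => rfl
  simp_rw [← hψ]
  rw [AddChar.sum_eq_ite]
  have : ψ = 0 ↔ b = 0 := by
    refine ⟨fun h => eq_zero_of_forall_traceChar_dotProduct fun j => ?_, fun h => ?_⟩
    · rw [← hψ, h]; rfl
    · ext j
      rw [hψ, h]
      simp
  simp [this]

end Phase

/-! ### The Pauli operators -/

section PauliOperators

variable {F : Type*} [Field F] [Fintype F] [DecidableEq F] {ι : Type*} [Fintype ι] [DecidableEq ι]

/-- Both products are multiples of `pauli (v + w)`; the quotient of the two phases is the character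
of the symplectic form. -/
theorem pauli_mul_eq_smul_pauli_mul (v w : (ι → F) × (ι → F)) :
    pauli v * pauli w = traceChar F (sympForm F ι w v) • (pauli w * pauli v) := by
  rw [pauli_mul, pauli_mul, smul_smul, ← AddChar.map_add_eq_mul, add_comm w v]
  congr 2
  rw [sympForm_apply, dotProduct_comm w.1]
  ring

theorem pauli_mem_unitaryGroup (v : (ι → F) × (ι → F)) :
    pauli v ∈ Matrix.unitaryGroup (ι → F) ℂ := by
  rw [Matrix.mem_unitaryGroup_iff']
  ext i j
  rw [Matrix.mul_apply, Finset.sum_eq_single (i + v.1)]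
  · by_cases h : i = j
    · subst h
      simp only [Matrix.star_eq_conjTranspose, Matrix.conjTranspose_apply, pauli_apply, if_true,
        Matrix.one_apply_eq]
      exact star_traceChar_mul_traceChar _
    · simp [pauli_apply, h]
  · intro k _ hk
    simp [pauli_apply, hk]
  · simp

/-- The positions of the nonzero entries determine `v.1`, the column `0` the scalar, and the
remaining columns the character, hence `v.2`. -/
theorem eq_of_smul_pauli_eq_smul_pauli {v w : (ι → F) × (ι → F)} {y z : ℂ} (hy : y ≠ 0)
    (h : y • pauli v = z • pauli w) : v = w := by
  have key (j : ι → F) : y * traceChar F (v.2 ⬝ᵥ j) =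
      z * if v.1 = w.1 then traceChar F (w.2 ⬝ᵥ j) else 0 := by
    simpa [pauli_apply] using congrFun (congrFun h (j + v.1)) j
  have h1 : v.1 = w.1 := by
    by_contra hne
    simpa [hne, hy] using key 0
  have hyz : y = z := by simpa [h1] using key 0
  refine Prod.ext h1 (sub_eq_zero.1 (eq_zero_of_forall_traceChar_dotProduct fun j => ?_))
  have h2 : traceChar F (v.2 ⬝ᵥ j) = traceChar F (w.2 ⬝ᵥ j) := by
    simpa [h1, ← hyz, hy] using key j
  rw [sub_dotProduct, sub_eq_add_neg, AddChar.map_add_eq_mul, h2, ← AddChar.map_add_eq_mul,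
    add_neg_cancel, AddChar.map_zero_eq_one]

/-- A nonzero shift leaves no diagonal entry; without a shift the trace is a character sum. -/
theorem trace_pauli (v : (ι → F) × (ι → F)) :
    (pauli v).trace = if v = 0 then (Fintype.card F : ℂ) ^ Fintype.card ι else 0 := by
  simp only [Matrix.trace, Matrix.diag_apply, pauli_apply]
  by_cases h1 : v.1 = 0
  · simp [h1, sum_traceChar_dotProduct, Prod.ext_iff]
  · simp [h1, Prod.ext_iff]

/-- Each further factor moves past the previous ones, so the exponents `0 + 1 + ⋯ + (n - 1)` add up
to `n.choose 2`. -/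
theorem pauli_pow (v : (ι → F) × (ι → F)) (n : ℕ) :
    pauli v ^ n = traceChar F (n.choose 2 * (v.2 ⬝ᵥ v.1)) • pauli (n • v) := by
  induction n with
  | zero => simp [pauli_zero]
  | succ n ih =>
    rw [pow_succ, ih, Matrix.smul_mul, pauli_mul, smul_smul, ← AddChar.map_add_eq_mul, succ_nsmul]
    congr 2
    rw [Nat.choose_succ_succ' n 1, Prod.smul_snd, ← Nat.cast_smul_eq_nsmul F, smul_dotProduct]
    simp
    ring

theorem pauli_pow_phaseOrder (v : (ι → F) × (ι → F)) : pauli v ^ phaseOrder F = 1 := by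
  rw [pauli_pow, cast_choose_phaseOrder_eq_zero, ← Nat.cast_smul_eq_nsmul F,
    cast_phaseOrder_eq_zero]
  simp [pauli_zero]

/-- The operator `ζ ^ i X(a) Z(b)` as an element of the unitary group. -/
noncomputable def pauliUnitary (i : ℕ) (v : (ι → F) × (ι → F)) :
    Matrix.unitaryGroup (ι → F) ℂ :=
  ⟨phase F ^ i • pauli v, by
    have h := Matrix.mem_unitaryGroup_iff'.1 (pauli_mem_unitaryGroup v)
    rw [Matrix.mem_unitaryGroup_iff', star_smul, Matrix.smul_mul, Matrix.mul_smul, h, smul_smul,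
      star_phase_mul_phase, one_smul]⟩

theorem coe_pauliUnitary (i : ℕ) (v : (ι → F) × (ι → F)) :
    (pauliUnitary i v : Matrix (ι → F) (ι → F) ℂ) = phase F ^ i • pauli v := rfl

/-- The group of all Pauli operators `ζ ^ i X(a) Z(b)` with `(a|b)` in `C`. -/
noncomputable def pauliSubgroup (C : Submodule F ((ι → F) × (ι → F))) :
    Subgroup (Matrix.unitaryGroup (ι → F) ℂ) where
  carrier := {g | ∃ i, ∃ v ∈ C, g = pauliUnitary i v}
  one_mem' := ⟨0, 0, C.zero_mem, Subtype.ext (by simp [coe_pauliUnitary, pauli_zero])⟩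
  mul_mem' := by
    rintro _ _ ⟨i, v, hv, rfl⟩ ⟨j, w, hw, rfl⟩
    obtain ⟨l, hl⟩ := traceChar_eq_phase_pow F (v.2 ⬝ᵥ w.1)
    refine ⟨i + j + l, v + w, C.add_mem hv hw, Subtype.ext ?_⟩
    rw [Matrix.UnitaryGroup.mul_val, coe_pauliUnitary, coe_pauliUnitary, coe_pauliUnitary,
      Matrix.smul_mul, Matrix.mul_smul, pauli_mul, hl, smul_smul, smul_smul, pow_add, pow_add,
      mul_assoc]
  inv_mem' := by
    rintro _ ⟨i, v, hv, rfl⟩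
    obtain ⟨l, hl⟩ := traceChar_eq_phase_pow F (v.2 ⬝ᵥ (-v).1)
    obtain ⟨j, hj⟩ := exists_phase_pow_mul_eq_one F (i + l)
    refine ⟨j, -v, C.neg_mem hv, inv_eq_of_mul_eq_one_right (Subtype.ext ?_)⟩
    rw [Matrix.UnitaryGroup.mul_val, coe_pauliUnitary, coe_pauliUnitary, Matrix.smul_mul,
      Matrix.mul_smul, pauli_mul, hl, smul_smul, smul_smul, add_neg_cancel, pauli_zero]
    rw [pow_add] at hj
    rw [show phase F ^ i * phase F ^ j * phase F ^ l = 1 by linear_combination hj, one_smul]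
    rfl

theorem pauliVectors_pauliSubgroup (C : Submodule F ((ι → F) × (ι → F))) :
    pauliVectors (pauliSubgroup C) = C := by
  ext v
  constructor
  · rintro ⟨_, ⟨i, w, hw, rfl⟩, j, h⟩
    rw [coe_pauliUnitary] at h
    rwa [← eq_of_smul_pauli_eq_smul_pauli (pow_ne_zero _ (phase_ne_zero F)) h]
  · exact fun hv => ⟨_, ⟨0, v, hv, rfl⟩, 0, rfl⟩

theorem pauliSubgroup_le (C : Submodule F ((ι → F) × (ι → F))) :
    pauliSubgroup C ≤ pauliGroup F ι := by
  rintro _ ⟨i, v, _, rfl⟩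
  exact ⟨i, v, rfl⟩

theorem finite_pauliSubgroup (C : Submodule F ((ι → F) × (ι → F))) :
    Finite (pauliSubgroup C) := by
  have : (Set.range fun p : Fin (phaseOrder F) × ((ι → F) × (ι → F)) =>
    pauliUnitary (p.1 : ℕ) p.2).Finite := Set.finite_range _
  refine (this.subset ?_).to_subtype
  rintro _ ⟨i, v, _, rfl⟩
  refine ⟨(⟨i % phaseOrder F, Nat.mod_lt _ (phaseOrder_pos F)⟩, v), Subtype.ext ?_⟩
  simp only [coe_pauliUnitary]
  conv_rhs => rw [← Nat.mod_add_div i (phaseOrder F), pow_add, pow_mul, phase_pow_phaseOrder,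
    one_pow, mul_one]

end PauliOperators

/-! ### Lifting isotropic subspaces to stabilizer groups -/

section Lift

variable {F : Type*} [Field F] [Fintype F] [DecidableEq F] {ι : Type*} [Fintype ι] [DecidableEq ι]

variable (F ι) in
/-- The subgroup of scalar matrices in the unitary group. -/
def scalarUnitary : Subgroup (Matrix.unitaryGroup (ι → F) ℂ) where
  carrier := {g | ∃ z : ℂ, (g : Matrix (ι → F) (ι → F) ℂ) = z • (1 : Matrix (ι → F) (ι → F) ℂ)}
  one_mem' := ⟨1, by simp⟩
  mul_mem' := by
    rintro g h ⟨y, hy⟩ ⟨z, hz⟩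
    exact ⟨y * z, by rw [Matrix.UnitaryGroup.mul_val, hy, hz]; simp [smul_smul, mul_comm]⟩
  inv_mem' := by
    rintro g ⟨y, hy⟩
    exact ⟨star y, by rw [Matrix.UnitaryGroup.inv_val, hy]; simp⟩

variable (F ι) in
/-- The scalar of a scalar unitary matrix. -/
def scalarUnitaryHom : scalarUnitary F ι →* ℂ where
  toFun g := (g : Matrix.unitaryGroup (ι → F) ℂ).1 0 0
  map_one' := by simp
  map_mul' := by
    rintro ⟨g, y, hy⟩ ⟨h, z, hz⟩
    simp [hy, hz, mul_comm]

theorem scalarUnitaryHom_apply {g : scalarUnitary F ι} {z : ℂ}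
    (h : (g : Matrix.unitaryGroup (ι → F) ℂ).1 = z • (1 : Matrix (ι → F) (ι → F) ℂ)) :
    scalarUnitaryHom F ι g = z := by
  simp [scalarUnitaryHom, h]

/-- A totally isotropic subspace is the set of vectors of some stabilizer group. -/
theorem exists_isStabilizerGroup {C : Submodule F ((ι → F) × (ι → F))}
    (hC : ∀ v ∈ C, ∀ w ∈ C, sympForm F ι v w = 0) :
    ∃ T : Subgroup (Matrix.unitaryGroup (ι → F) ℂ),
      IsStabilizerGroup T ∧ pauliVectors T = C := by
  -- Isotropy makes this group Abelian, but it contains all the phases as scalars. These are cut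
  -- away by a character.
  let A := pauliSubgroup C
  have hcomm : ∀ a b : A, a * b = b * a := by
    rintro ⟨_, i, v, hv, rfl⟩ ⟨_, j, w, hw, rfl⟩
    apply Subtype.ext
    apply Subtype.ext
    simp only [Subgroup.coe_mul, Matrix.UnitaryGroup.mul_val, coe_pauliUnitary, Matrix.smul_mul,
      Matrix.mul_smul]
    rw [pauli_mul_eq_smul_pauli_mul, hC w hw v hv, AddChar.map_zero_eq_one, one_smul, smul_comm]
  let : CommGroup A := { (inferInstance : Group A) with mul_comm := hcomm }
  have : Finite A := finite_pauliSubgroup C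
  let H : Subgroup A := (scalarUnitary F ι).comap A.subtype
  let χ₀ : H →* ℂˣ := ((scalarUnitaryHom F ι).comp
    ((A.subtype.comp H.subtype).codRestrict (scalarUnitary F ι) fun h => h.2)).toHomUnits
  -- Characters of a subgroup of a finite Abelian group extend. On scalars `χ` is the scalar itself,
  -- so a scalar in its kernel is `1`.
  obtain ⟨χ, hχ⟩ := MonoidHom.domRestrict_surjective (G := A) ℂ H χ₀
  have hχ_scalar (a : A) (z : ℂ)
      (ha : (a : Matrix.unitaryGroup (ι → F) ℂ).1 = z • (1 : Matrix (ι → F) (ι → F) ℂ)) :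
      (χ a : ℂ) = z := by
    have h1 : χ a = χ₀ ⟨a, z, ha⟩ := by rw [← hχ]; rfl
    rw [h1]
    exact scalarUnitaryHom_apply ha
  refine ⟨χ.ker.map A.subtype, ⟨?_, ?_, ?_⟩, ?_⟩
  · rintro _ ⟨a, _, rfl⟩
    exact pauliSubgroup_le C a.2
  · rintro _ ⟨a, _, rfl⟩ _ ⟨b, _, rfl⟩
    exact congrArg A.subtype (hcomm a b)
  · rintro _ ⟨a, ha, rfl⟩ z hz
    have h1 := hχ_scalar a z hz
    rw [MonoidHom.mem_ker.1 ha, Units.val_one] at h1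
    rw [← h1, one_smul] at hz
    exact Subtype.ext hz
  · apply Set.Subset.antisymm
    · conv_rhs => rw [← pauliVectors_pauliSubgroup C]
      rintro v ⟨_, ⟨a, _, rfl⟩, h⟩
      exact ⟨a, a.2, h⟩
    · intro v hv
      let a : A := ⟨pauliUnitary 0 v, 0, v, hv, rfl⟩
      -- Hence `χ a` is a power of `phase F`, and multiplying `a` by the inverse phase, which lies
      -- in `A`, moves it into the kernel without changing its vector.
      have ha : a ^ phaseOrder F = 1 := by
        apply Subtype.ext
        apply Subtype.ext
        simp [a, coe_pauliUnitary, pauli_pow_phaseOrder]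
      have hχa : (χ a : ℂ) ^ phaseOrder F = 1 := by
        rw [← Units.val_pow_eq_pow_val, ← map_pow, ha, map_one, Units.val_one]
      have := NeZero.of_pos (phaseOrder_pos F)
      obtain ⟨i, _, hi⟩ := (isPrimitiveRoot_phase F).eq_pow_of_pow_eq_one hχa
      obtain ⟨j, hj⟩ := exists_phase_pow_mul_eq_one F i
      let s : A := ⟨pauliUnitary j 0, j, 0, C.zero_mem, rfl⟩
      have hs : (χ s : ℂ) = phase F ^ j := hχ_scalar s _ (by
        simp [s, coe_pauliUnitary, pauli_zero])
      refine ⟨_, ⟨s * a, ?_, rfl⟩, j, ?_⟩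
      · rw [SetLike.mem_coe, MonoidHom.mem_ker]
        apply Units.ext
        rw [map_mul, Units.val_mul, hs, ← hi, hj, Units.val_one]
      · simp [s, a, coe_pauliUnitary, pauli_zero]

end Lift

/-! ### The code of a stabilizer group -/

section StabilizerCode

variable {F : Type*} [Field F] [Fintype F] [DecidableEq F] {ι : Type*} [Fintype ι] [DecidableEq ι]
  {T : Subgroup (Matrix.unitaryGroup (ι → F) ℂ)}

/-- Up to phases, the elements of a stabilizer group are determined by their vectors. -/
theorem IsStabilizerGroup.exists_equiv (hT : IsStabilizerGroup T) :
    ∃ e : T ≃ pauliVectors T, ∀ g : T, ∃ i : ℕ,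
      (g : Matrix.unitaryGroup (ι → F) ℂ).1 = phase F ^ i • pauli (e g : (ι → F) × (ι → F)) := by
  have h (g : T) : ∃ v : pauliVectors T, ∃ i : ℕ,
      (g : Matrix.unitaryGroup (ι → F) ℂ).1 = phase F ^ i • pauli (v : (ι → F) × (ι → F)) := by
    obtain ⟨i, v, hv⟩ := hT.le_pauli g.2
    exact ⟨⟨v, g, g.2, i, hv⟩, i, hv⟩
  choose e he using h
  refine ⟨Equiv.ofBijective e ⟨fun g h hgh => ?_, ?_⟩, he⟩
  · obtain ⟨i, hi⟩ := he g
    obtain ⟨j, hj⟩ := he h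
    obtain ⟨l, hl⟩ := exists_phase_pow_mul_eq_one F j
    -- Two elements with the same vector differ by a scalar, and the only scalar in `T` is the
    -- identity.
    have hmul : (g : Matrix.unitaryGroup (ι → F) ℂ).1 = (phase F ^ i * phase F ^ l) •
        (h : Matrix.unitaryGroup (ι → F) ℂ).1 := by
      rw [hi, hj, hgh, smul_smul, mul_assoc, hl, mul_one]
    have h1 := hT.no_scalar _ (g * h⁻¹).2 (phase F ^ i * phase F ^ l) (by
      rw [Subgroup.coe_mul, Matrix.UnitaryGroup.mul_val, hmul, Matrix.smul_mul,
        ← Matrix.UnitaryGroup.mul_val, Subgroup.coe_inv, mul_inv_cancel,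
        Matrix.UnitaryGroup.one_val])
    exact mul_inv_eq_one.1 (Subtype.ext h1)
  · rintro ⟨v, g, hg, i, hv⟩
    refine ⟨⟨g, hg⟩, Subtype.ext ?_⟩
    obtain ⟨j, hj⟩ := he ⟨g, hg⟩
    exact eq_of_smul_pauli_eq_smul_pauli (pow_ne_zero j (phase_ne_zero F)) (hj.symm.trans hv)

theorem IsStabilizerGroup.finite (hT : IsStabilizerGroup T) : Finite T :=
  let ⟨e, _⟩ := hT.exists_equiv
  Finite.of_equiv _ e.symm

theorem IsStabilizerGroup.trace_eq_zero (hT : IsStabilizerGroup T) {g} (hg : g ∈ T) (h1 : g ≠ 1) :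
    (g : Matrix (ι → F) (ι → F) ℂ).trace = 0 := by
  obtain ⟨i, v, hv⟩ := hT.le_pauli hg
  have hv0 : v ≠ 0 := by
    rintro rfl
    exact h1 (hT.no_scalar g hg (phase F ^ i) (by rw [hv, pauli_zero]))
  rw [hv, Matrix.trace_smul, trace_pauli, if_neg hv0, smul_zero]

variable (T) in
/-- The projection onto the fixed space of a finite group of unitary matrices. -/
noncomputable def stabProj [Fintype T] : Matrix (ι → F) (ι → F) ℂ :=
  (Fintype.card T : ℂ)⁻¹ • ∑ g : T, (g : Matrix.unitaryGroup (ι → F) ℂ).1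

omit [Field F] in
theorem isProj_stabProj [Fintype T] :
    LinearMap.IsProj (fixedSpace T) (stabProj T).mulVecLin where
  map_mem x h hh := by
    rw [Matrix.mulVecLin_apply, stabProj, Matrix.mulVec_mulVec, Matrix.mul_smul, Finset.mul_sum]
    congr 2
    refine Fintype.sum_equiv (Equiv.mulLeft (⟨h, hh⟩ : T)) _ _ fun g => ?_
    simp
  map_id x hx := by
    rw [Matrix.mulVecLin_apply, stabProj, Matrix.smul_mulVec, Matrix.sum_mulVec,
      Finset.sum_congr rfl fun (g : T) _ => hx g.1 g.2, Finset.sum_const, Finset.card_univ,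
      ← Nat.cast_smul_eq_nsmul ℂ, smul_smul, inv_mul_cancel₀ (by simp), one_smul]

omit [Field F] in
theorem trace_mul_stabProj [Fintype T] (E : Matrix (ι → F) (ι → F) ℂ) :
    (E * stabProj T).trace = (Fintype.card T : ℂ)⁻¹ *
      ∑ g : T, (E * (g : Matrix.unitaryGroup (ι → F) ℂ).1).trace := by
  rw [stabProj, Matrix.mul_smul, Matrix.trace_smul, Finset.mul_sum, Matrix.trace_sum, smul_eq_mul]

omit [Field F] in
theorem trace_stabProj [Fintype T] :
    (stabProj T).trace = Module.finrank ℂ (fixedSpace T) := by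
  rw [← isProj_stabProj.trace, ← Matrix.toLin'_apply', Matrix.trace_toLin'_eq]

/-- The dimension of the code of a stabilizer group. -/
theorem IsStabilizerGroup.finrank_fixedSpace_mul_card (hT : IsStabilizerGroup T) :
    Module.finrank ℂ (fixedSpace T) * Nat.card (pauliVectors T) =
      Fintype.card F ^ Fintype.card ι := by
  have := hT.finite
  have := Fintype.ofFinite T
  obtain ⟨e, -⟩ := hT.exists_equiv
  -- The trace of the projection is the dimension of the code; in the average over `T` only the
  -- identity has nonzero trace.
  have h := trace_mul_stabProj (T := T) 1
  rw [one_mul, trace_stabProj, Finset.sum_eq_single 1 (fun g _ hg => by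
    rw [one_mul]
    exact hT.trace_eq_zero g.2 fun h => hg (Subtype.ext h)) (by simp)] at h
  have h1 : ((1 : T) : Matrix.unitaryGroup (ι → F) ℂ).1 = 1 := rfl
  rw [h1, one_mul, Matrix.trace_one, eq_inv_mul_iff_mul_eq₀ (by simp)] at h
  rw [← Nat.card_congr e, Nat.card_eq_fintype_card, mul_comm]
  simpa using (by exact_mod_cast h : Fintype.card T * Module.finrank ℂ (fixedSpace T) =
    Fintype.card (ι → F))

theorem star_dotProduct_unitary_mulVec {X : Type*} [Fintype X] [DecidableEq X]
    (g : Matrix.unitaryGroup X ℂ) {x : X → ℂ} (hx : g.1 *ᵥ x = x) (y : X → ℂ) :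
    star x ⬝ᵥ (g.1 *ᵥ y) = star x ⬝ᵥ y := by
  conv_lhs => rw [← hx]
  rw [Matrix.star_mulVec, ← Matrix.dotProduct_mulVec, Matrix.mulVec_mulVec,
    ← Matrix.star_eq_conjTranspose, Matrix.mem_unitaryGroup_iff'.1 g.2, Matrix.one_mulVec]

/-- A Pauli operator that does not commute with a stabilizer group maps the code to its orthogonal
complement. -/
theorem star_dotProduct_pauli_mulVec_eq_zero {v w : (ι → F) × (ι → F)} (hw : w ∈ pauliVectors T)
    (hvw : traceChar F (sympForm F ι w v) ≠ 1) {x y : (ι → F) → ℂ} (hx : x ∈ fixedSpace T)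
    (hy : y ∈ fixedSpace T) : star x ⬝ᵥ (pauli v *ᵥ y) = 0 := by
  obtain ⟨g, hg, i, hgw⟩ := hw
  have hmul : pauli v * g.1 = traceChar F (sympForm F ι w v) • (g.1 * pauli v) := by
    rw [hgw, Matrix.mul_smul, pauli_mul_eq_smul_pauli_mul, Matrix.smul_mul, smul_comm]
  -- Insert `g` in front of `y`, commute it past `pauli v` at the cost of the character, and absorb
  -- it into `x`.
  have h : star x ⬝ᵥ (pauli v *ᵥ y) =
      traceChar F (sympForm F ι w v) * (star x ⬝ᵥ (pauli v *ᵥ y)) := by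
    conv_lhs => rw [← hy g hg, Matrix.mulVec_mulVec, hmul, Matrix.smul_mulVec,
      ← Matrix.mulVec_mulVec, dotProduct_smul, star_dotProduct_unitary_mulVec g (hx g hg)]
    rfl
  by_contra h0
  exact hvw (mul_right_cancel₀ h0 (by rw [← h, one_mul]))

theorem detects_of_traceChar_ne_one {v w : (ι → F) × (ι → F)} (hw : w ∈ pauliVectors T)
    (hvw : traceChar F (sympForm F ι w v) ≠ 1) : Detects (fixedSpace T) (pauli v) :=
  ⟨0, fun _ hx _ hy => by rw [star_dotProduct_pauli_mulVec_eq_zero hw hvw hx hy, zero_mul]⟩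

/-- Up to a phase the operator is an element of `T`, so it acts on the code as a scalar. -/
theorem detects_of_mem_pauliVectors {v : (ι → F) × (ι → F)} (hv : v ∈ pauliVectors T) :
    Detects (fixedSpace T) (pauli v) := by
  obtain ⟨g, hg, i, hgv⟩ := hv
  obtain ⟨j, hj⟩ := exists_phase_pow_mul_eq_one F i
  refine ⟨phase F ^ j, fun x _ y hy => ?_⟩
  have h : pauli v = phase F ^ j • g.1 := by rw [hgv, smul_smul, hj, one_smul]
  rw [h, Matrix.smul_mulVec, hy g hg, dotProduct_smul, smul_eq_mul]

-- The operator preserves the code, so detection would make it a scalar `z` there. Comparing traces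
-- against the projection forces `z = 0`, which is impossible for a unitary operator on a nonzero
-- space.
open scoped ComplexOrder in
theorem IsStabilizerGroup.not_detects (hT : IsStabilizerGroup T) {v : (ι → F) × (ι → F)}
    (hv : v ∉ pauliVectors T)
    (hcomm : ∀ w ∈ pauliVectors T, sympForm F ι w v = 0) : ¬ Detects (fixedSpace T) (pauli v) := by
  rintro ⟨z, hz⟩
  have := hT.finite
  have := Fintype.ofFinite T
  obtain ⟨e, he⟩ := hT.exists_equiv
  have hmem {y : (ι → F) → ℂ} (hy : y ∈ fixedSpace T) : pauli v *ᵥ y ∈ fixedSpace T := by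
    intro g hg
    obtain ⟨i, hi⟩ := he ⟨g, hg⟩
    have hc : g.1 * pauli v = pauli v * g.1 := by
      rw [hi, Matrix.mul_smul, pauli_mul_eq_smul_pauli_mul v, hcomm _ (e ⟨g, hg⟩).2,
        AddChar.map_zero_eq_one, one_smul, Matrix.smul_mul]
    rw [Matrix.mulVec_mulVec, hc, ← Matrix.mulVec_mulVec, hy g hg]
  -- The difference of the two sides is a code vector; testing the Knill-Laflamme condition against
  -- it shows that its norm is zero.
  have hscalar {y : (ι → F) → ℂ} (hy : y ∈ fixedSpace T) : pauli v *ᵥ y = z • y := by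
    have hx : pauli v *ᵥ y - z • y ∈ fixedSpace T :=
      (fixedSpace T).sub_mem (hmem hy) ((fixedSpace T).smul_mem z hy)
    have h := hz _ hx y hy
    rw [← smul_eq_mul, ← dotProduct_smul, ← sub_eq_zero, ← dotProduct_sub] at h
    exact sub_eq_zero.1 (dotProduct_star_self_eq_zero.1 h)
  have hP : pauli v * stabProj T = z • stabProj T := by
    apply Matrix.toLin'.injective
    refine LinearMap.ext fun x => ?_
    simpa [Matrix.mulVec_mulVec, Matrix.smul_mulVec] using
      hscalar (isProj_stabProj (T := T).map_mem x)
  have htr : (pauli v * stabProj T).trace = 0 := by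
    rw [trace_mul_stabProj, Finset.sum_eq_zero, mul_zero]
    intro g _
    obtain ⟨i, hi⟩ := he g
    rw [hi, Matrix.mul_smul, Matrix.trace_smul, pauli_mul, Matrix.trace_smul, trace_pauli, if_neg,
      smul_zero, smul_zero]
    -- If the vectors of `pauli v` and `g` cancel, then `v` is the vector of `g⁻¹`, against `hv`.
    intro h0
    apply hv
    obtain ⟨j, hj⟩ := he g⁻¹
    have h1 : g.1.1 * g⁻¹.1.1 = 1 := by
      rw [← Matrix.UnitaryGroup.mul_val, ← Subgroup.coe_mul, mul_inv_cancel]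
      rfl
    rw [hi, hj, Matrix.smul_mul, Matrix.mul_smul, pauli_mul, smul_smul, smul_smul, ← pauli_zero,
      ← one_smul ℂ (pauli 0)] at h1
    have h2 := eq_of_smul_pauli_eq_smul_pauli (mul_ne_zero (mul_ne_zero
      (pow_ne_zero _ (phase_ne_zero F)) (pow_ne_zero _ (phase_ne_zero F)))
      (traceChar_ne_zero _)) h1
    rw [eq_neg_of_add_eq_zero_left h0, ← eq_neg_of_add_eq_zero_right h2]
    exact (e g⁻¹).2
  have hpos : Module.finrank ℂ (fixedSpace T) ≠ 0 := by
    intro h0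
    have := hT.finrank_fixedSpace_mul_card
    rw [h0, zero_mul] at this
    exact (pow_ne_zero _ Fintype.card_ne_zero) this.symm
  rw [hP, Matrix.trace_smul, trace_stabProj, smul_eq_mul, mul_eq_zero] at htr
  have hz0 : z = 0 := htr.resolve_right (by exact_mod_cast hpos)
  apply hpos
  rw [Submodule.finrank_eq_zero, eq_bot_iff]
  intro y hy
  have h := congrArg ((star (pauli v)) *ᵥ ·) (hscalar hy)
  simpa [Matrix.mulVec_mulVec, Matrix.mem_unitaryGroup_iff'.1 (pauli_mem_unitaryGroup v), hz0]
    using h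

end StabilizerCode

/-! ### Orthonormal families -/

/-- A space of complex vectors of dimension at least `|J|` contains an orthonormal family indexed by
`J`, which spans it in case of equality. -/
theorem exists_orthonormal_family {X J : Type*} [Fintype X] [Fintype J] [DecidableEq J]
    (Q : Submodule ℂ (X → ℂ)) (hJ : Fintype.card J ≤ Module.finrank ℂ Q) :
    ∃ ψ : J → X → ℂ, (∀ j, ψ j ∈ Q) ∧
      (∀ i j, star (ψ i) ⬝ᵥ ψ j = if i = j then 1 else 0) ∧
      (Fintype.card J = Module.finrank ℂ Q → Submodule.span ℂ (Set.range ψ) = Q) := by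
  let E := (WithLp.linearEquiv 2 ℂ (X → ℂ)).symm
  let Q' : Submodule ℂ (EuclideanSpace ℂ X) := Q.map E.toLinearMap
  have hQ' : Module.finrank ℂ Q' = Module.finrank ℂ Q := E.finrank_map_eq Q
  let b := stdOrthonormalBasis ℂ Q'
  obtain ⟨e⟩ : Nonempty (J ↪ Fin (Module.finrank ℂ Q')) :=
    Function.Embedding.nonempty_of_card_le (by simpa [hQ'] using hJ)
  have hon : Orthonormal ℂ fun j => (b (e j) : EuclideanSpace ℂ X) :=
    (b.orthonormal.comp e e.injective).comp_linearIsometry Q'.subtypeₗᵢ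
  refine ⟨fun j => WithLp.ofLp (b (e j) : EuclideanSpace ℂ X), fun j => ?_, fun i j => ?_,
    fun h => ?_⟩
  · obtain ⟨x, hx, hxb⟩ := (b (e j)).2
    simp only [← hxb]
    exact hx
  · rw [dotProduct_comm, ← EuclideanSpace.inner_eq_star_dotProduct]
    exact orthonormal_iff_ite.1 hon i j
  · have hli : LinearIndependent ℂ fun j => WithLp.ofLp (b (e j) : EuclideanSpace ℂ X) :=
      hon.linearIndependent.map' E.symm.toLinearMap (LinearEquiv.ker _)
    refine Submodule.eq_of_le_of_finrank_eq (Submodule.span_le.2 ?_) ?_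
    · rintro _ ⟨j, rfl⟩
      obtain ⟨x, hx, hxb⟩ := (b (e j)).2
      simp only [← hxb]
      exact hx
    · rw [finrank_span_eq_card hli, h]

/-! ### Codes on the qudits of Alice and Bob -/

section Bipartite

variable {F : Type*} [Field F] [Fintype F] [DecidableEq F] {ι κ : Type*} [Fintype ι]
  [DecidableEq ι] [Fintype κ] [DecidableEq κ]

/-- A function all of whose nontrivial Fourier coefficients vanish is constant. -/
theorem card_pow_mul_eq_sum_of_fourier {g : (κ → F) → ℂ}
    (hg : ∀ b ≠ 0, ∑ z, traceChar F (b ⬝ᵥ z) * g z = 0) (z : κ → F) :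
    (Fintype.card F : ℂ) ^ Fintype.card κ * g z = ∑ z, g z := by
  -- Fourier inversion at `z`: only the coefficient at `b = 0` survives, while exchanging the sums
  -- isolates `g z`.
  have h : ∑ b : κ → F, traceChar F (b ⬝ᵥ -z) * ∑ y, traceChar F (b ⬝ᵥ y) * g y = ∑ y, g y := by
    rw [Finset.sum_eq_single 0 (fun b _ hb => by rw [hg b hb, mul_zero]) (by simp)]
    simp
  rw [← h]
  simp_rw [Finset.mul_sum]
  rw [Finset.sum_comm, Finset.sum_eq_single z]
  · simp [← mul_assoc, ← AddChar.map_add_eq_mul]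
  · intro y _ hy
    simp_rw [← mul_assoc, ← AddChar.map_add_eq_mul, ← dotProduct_add, ← Finset.sum_mul]
    simp_rw [dotProduct_comm _ (-z + y), sum_traceChar_dotProduct]
    rw [if_neg, zero_mul]
    rwa [neg_add_eq_zero, eq_comm]
  · simp

/-- The operator `tr_A |y⟩⟨x|` on the qudits indexed by `κ`, transposed. -/
def partialGram (x y : (ι ⊕ κ → F) → ℂ) (z z' : κ → F) : ℂ :=
  ∑ a : ι → F, star (x (Sum.elim a z)) * y (Sum.elim a z')

omit [DecidableEq F] [DecidableEq ι] [DecidableEq κ] [Field F] in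
theorem sum_sumElim [DecidableEq ι] [DecidableEq κ] (g : (ι ⊕ κ → F) → ℂ) :
    ∑ y, g y = ∑ z : κ → F, ∑ a : ι → F, g (Sum.elim a z) := by
  rw [Finset.sum_comm, ← Fintype.sum_prod_type' (f := fun a z => g (Sum.elim a z))]
  exact Fintype.sum_equiv (Equiv.sumArrowEquivProdArrow ι κ F) _ _ fun y =>
    congrArg g (Sum.elim_comp_inl_inr y).symm

/-- Matrix elements of Bob's Pauli operators are the Fourier coefficients of the shifted diagonals
of `partialGram`. -/
theorem star_dotProduct_pauli_mulVec (x y : (ι ⊕ κ → F) → ℂ) (a b : κ → F) :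
    star x ⬝ᵥ (pauli (Sum.elim (0 : ι → F) a, Sum.elim (0 : ι → F) b) *ᵥ y) =
      ∑ z, traceChar F (b ⬝ᵥ z) * partialGram x y (z + a) z := by
  simp only [dotProduct, Matrix.mulVec, pauli_apply, Finset.mul_sum]
  rw [Finset.sum_comm, sum_sumElim]
  refine Finset.sum_congr rfl fun z _ => ?_
  rw [partialGram, Finset.mul_sum]
  refine Finset.sum_congr rfl fun s _ => ?_
  have h1 : (Sum.elim s z + Sum.elim (0 : ι → F) a) = Sum.elim s (z + a) := by
    ext (i | i) <;> simp
  rw [Finset.sum_eq_single (Sum.elim s (z + a))]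
  · simp only [h1, if_true, Pi.star_apply, Fintype.sum_sum_type, Sum.elim_inl, Sum.elim_inr,
      Pi.zero_apply, zero_mul, Finset.sum_const_zero, zero_add]
    ring
  · intro w _ hw
    rw [h1, if_neg hw]
    simp
  · simp

/-- Bob's part of a code vector is maximally mixed if no Pauli operator on his side commutes with
the stabilizer group. -/
theorem card_pow_mul_partialGram
    {T : Subgroup (Matrix.unitaryGroup (ι ⊕ κ → F) ℂ)}
    (hT : ∀ a b : κ → F, (a, b) ≠ 0 → ∃ w ∈ pauliVectors T,
      traceChar F (sympForm F _ w (Sum.elim (0 : ι → F) a, Sum.elim (0 : ι → F) b)) ≠ 1)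
    {x y : (ι ⊕ κ → F) → ℂ} (hx : x ∈ fixedSpace T) (hy : y ∈ fixedSpace T) (z z' : κ → F) :
    (Fintype.card F : ℂ) ^ Fintype.card κ * partialGram x y z z' =
      if z = z' then star x ⬝ᵥ y else 0 := by
  have key (a b : κ → F) (hab : (a, b) ≠ 0) :
      ∑ z, traceChar F (b ⬝ᵥ z) * partialGram x y (z + a) z = 0 := by
    obtain ⟨w, hw, hne⟩ := hT a b hab
    rw [← star_dotProduct_pauli_mulVec, star_dotProduct_pauli_mulVec_eq_zero hw hne hx hy]
  split_ifs with h
  -- On the main diagonal the coefficients with `b ≠ 0` vanish, so it is constant, with sum `star x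
  -- ⬝ᵥ y`.
  · subst h
    have h1 := card_pow_mul_eq_sum_of_fourier (g := fun z => partialGram x y (z + 0) z)
      (fun b hb => key 0 b (by simpa using hb)) z
    have h2 := star_dotProduct_pauli_mulVec x y 0 0
    simp only [zero_dotProduct, AddChar.map_zero_eq_one, one_mul, Sum.elim_zero_zero] at h2
    rw [← h2, show ((0 : ι ⊕ κ → F), (0 : ι ⊕ κ → F)) = 0 from rfl, pauli_zero,
      Matrix.one_mulVec, add_zero] at h1
    exact h1
  -- On a shifted diagonal the coefficient at `b = 0` vanishes too, so the constant is zero.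
  · have ha : z - z' ≠ 0 := sub_ne_zero.2 h
    have h1 := card_pow_mul_eq_sum_of_fourier (g := fun y' => partialGram x y (y' + (z - z')) y')
      (fun b _ => key (z - z') b (by simp [ha])) z'
    have h2 := key (z - z') 0 (by simp [ha])
    simp only [zero_dotProduct, AddChar.map_zero_eq_one, one_mul] at h2
    rwa [h2, add_sub_cancel] at h1

/-- A stabilizer code that restricts to maximally mixed states on Bob's side is the range of an
entanglement-assisted encoder. -/
theorem exists_eaEncoder {n k c : ℕ} {T : Subgroup (Matrix.unitaryGroup (Fin n ⊕ Fin c → F) ℂ)}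
    (hT : ∀ a b : Fin c → F, (a, b) ≠ 0 → ∃ w ∈ pauliVectors T,
      traceChar F (sympForm F _ w (Sum.elim (0 : Fin n → F) a, Sum.elim (0 : Fin n → F) b)) ≠ 1)
    (hk : Module.finrank ℂ (fixedSpace T) = Fintype.card F ^ k) :
    ∃ V : Matrix (Fin n → F) ((Fin k → F) × (Fin c → F)) ℂ,
      Vᴴ * V = 1 ∧ fixedSpace T = LinearMap.range (eaEncoder V).mulVecLin := by
  have hcard : Fintype.card (Fin k → F) = Module.finrank ℂ (fixedSpace T) := by simp [hk]
  obtain ⟨ψ, hψ, hon, hspan⟩ := exists_orthonormal_family (fixedSpace T) hcard.le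
  set s : ℝ := Real.sqrt ((Fintype.card F : ℝ) ^ c) with hs
  have hs2 : (s : ℂ) * s = (Fintype.card F : ℂ) ^ c := by
    rw [← Complex.ofReal_mul, hs, Real.mul_self_sqrt (by positivity)]
    simp
  have hs0 : (s : ℂ) ≠ 0 := by
    intro h0
    rw [h0, zero_mul] at hs2
    exact pow_ne_zero c (Nat.cast_ne_zero.2 Fintype.card_ne_zero) hs2.symm
  -- Slice each basis vector along Bob's coordinates. The factor `s = q^(c/2)` turns the maximally
  -- mixed Gram matrix into the identity and cancels the normalization of `maxEntangled`.
  refine ⟨Matrix.of fun y p => s * ψ p.1 (Sum.elim y p.2), ?_, ?_⟩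
  · ext ⟨i, z⟩ ⟨j, z'⟩
    have h := card_pow_mul_partialGram hT (hψ i) (hψ j) z z'
    rw [hon, Fintype.card_fin, ← hs2, partialGram, Finset.mul_sum] at h
    rw [Matrix.mul_apply, Matrix.one_apply]
    simp only [Matrix.conjTranspose_apply, Matrix.of_apply, Prod.mk.injEq]
    simp only [and_comm (a := i = j), ite_and]
    rw [← h]
    refine Finset.sum_congr rfl fun a _ => ?_
    rw [star_mul', Complex.star_def, Complex.conj_ofReal]
    ring
  · rw [Matrix.range_mulVecLin, ← hspan hcard]
    congr 2
    funext j
    ext y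
    simp only [Matrix.col_apply, eaEncoder, Matrix.of_apply, maxEntangled]
    rw [Finset.sum_eq_single (y ∘ Sum.inr) (fun z _ hz => by rw [if_neg hz, mul_zero]) (by simp)]
    rw [if_pos rfl, Sum.elim_comp_inl_inr, ← hs, Complex.ofReal_inv]
    field_simp

end Bipartite

/-! ### The symplectic form and the Hermitian form -/

section Codes

variable {F K : Type*} [Field F] [Fintype F] [Field K] [Algebra F K] {ι : Type*} [Fintype ι]

/-- If `β^q = tβ` with `t` in `F`, then `β^(q-1) = t` is a unit of `F`, so its `(q-1)`-st power is
`1`. -/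
theorem isNormalBasis_of_pow_ne (hK : Module.finrank F K = 2) {β : K} (h0 : β ≠ 0)
    (h : β ^ ((Fintype.card F - 1) * (Fintype.card F - 1)) ≠ 1) : IsNormalBasis F β := by
  have hli : LinearIndependent F ![β, β ^ Fintype.card F] := by
    rw [LinearIndependent.pair_iff' h0]
    intro t ht
    have hq : Fintype.card F = Fintype.card F - 1 + 1 := (Nat.sub_add_cancel Fintype.card_pos).symm
    have h1 : β ^ (Fintype.card F - 1) = algebraMap F K t := by
      apply mul_right_cancel₀ h0
      rw [← pow_succ, ← hq, ← ht, Algebra.smul_def]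
    have ht0 : t ≠ 0 := by
      rintro rfl
      rw [map_zero] at h1
      exact h0 (eq_zero_of_pow_eq_zero h1)
    apply h
    rw [pow_mul, h1, ← map_pow, FiniteField.pow_card_sub_one_eq_one t ht0, map_one]
  refine ⟨hli, ?_⟩
  have := hli.span_eq_top_of_card_eq_finrank (by simp [hK])
  simpa [Set.pair_comm] using this

/-- A generator of `Kˣ` works: its order `q² - 1` exceeds `(q - 1)²`. -/
theorem exists_isNormalBasis (hK : Module.finrank F K = 2) : ∃ β : K, IsNormalBasis F β := by
  have : Module.Finite F K := Module.finite_of_finrank_eq_succ hK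
  have : Finite K := Module.finite_of_finite F
  have := Fintype.ofFinite K
  obtain ⟨g, hg⟩ := IsCyclic.exists_generator (α := Kˣ)
  refine ⟨g, isNormalBasis_of_pow_ne hK g.ne_zero fun h => ?_⟩
  have ho : orderOf g = Fintype.card F ^ 2 - 1 := by
    classical
    rw [orderOf_eq_card_of_forall_mem_zpowers hg, Nat.card_units, Nat.card_eq_fintype_card,
      Module.card_eq_pow_finrank (K := F), hK]
  have hdvd := orderOf_dvd_of_pow_eq_one (Units.ext (by simpa using h) :
    g ^ ((Fintype.card F - 1) * (Fintype.card F - 1)) = 1)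
  rw [ho] at hdvd
  have h1 : 1 < Fintype.card F := Fintype.one_lt_card
  obtain ⟨p, hp⟩ := Nat.exists_eq_add_of_lt h1
  rw [show Fintype.card F - 1 = p + 1 by omega,
    show Fintype.card F ^ 2 - 1 = (p + 1) * (p + 1) + 2 * (p + 1) by
      rw [hp, Nat.sub_eq_iff_eq_add (by nlinarith)]; ring] at hdvd
  have := Nat.le_of_dvd (by positivity) hdvd
  omega

namespace IsNormalBasis

variable {β : K}

omit [Fintype ι] in
theorem phi_eq_zero (hβ : IsNormalBasis F β) {s t : F}
    (h : β * algebraMap F K s + β ^ Fintype.card F * algebraMap F K t = 0) : s = 0 ∧ t = 0 :=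
  LinearIndependent.pair_iff.1 hβ.1 s t (by
    rw [Algebra.smul_def, Algebra.smul_def]; linear_combination h)

theorem exists_phi_eq (hβ : IsNormalBasis F β) (x : K) :
    ∃ s t : F, β * algebraMap F K s + β ^ Fintype.card F * algebraMap F K t = x := by
  have hx : x ∈ Submodule.span F {β, β ^ Fintype.card F} := hβ.2 ▸ Submodule.mem_top
  obtain ⟨s, t, h⟩ := Submodule.mem_span_pair.1 hx
  refine ⟨s, t, ?_⟩
  rw [← h, Algebra.smul_def, Algebra.smul_def]
  ring

variable (ι) in
/-- The map `φ(a|b) = β a + β^q b` as a linear equivalence. -/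
noncomputable def phiEquiv (hβ : IsNormalBasis F β) : ((ι → F) × (ι → F)) ≃ₗ[F] (ι → K) :=
  LinearEquiv.ofBijective
    { toFun := phi F β
      map_add' := fun v w => by
        ext j; simp only [phi, Prod.fst_add, Prod.snd_add, Pi.add_apply, map_add]; ring
      map_smul' := fun t v => by
        ext j
        rw [RingHom.id_apply, Pi.smul_apply, Algebra.smul_def t (phi F β v j)]
        simp only [phi, Prod.smul_fst, Prod.smul_snd, Pi.smul_apply, smul_eq_mul, map_mul]
        ring }
    ⟨(injective_iff_map_eq_zero _).2 fun v hv =>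
      Prod.ext (funext fun j => (hβ.phi_eq_zero (congrFun hv j)).1)
        (funext fun j => (hβ.phi_eq_zero (congrFun hv j)).2), fun x => by
      choose s t h using fun j => hβ.exists_phi_eq (x j)
      exact ⟨(s, t), funext h⟩⟩

omit [Fintype ι] in
theorem phiEquiv_apply (hβ : IsNormalBasis F β) (v : (ι → F) × (ι → F)) :
    hβ.phiEquiv ι v = phi F β v := rfl

theorem hammingNorm_phi [DecidableEq F] [DecidableEq K] (hβ : IsNormalBasis F β)
    (v : (ι → F) × (ι → F)) : hammingNorm (phi F β v) = pauliWeight v := by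
  rw [hammingNorm, pauliWeight]
  congr 1
  ext j
  simp only [Finset.mem_filter, Finset.mem_univ, true_and]
  rw [← not_and_or, not_iff_not]
  refine ⟨hβ.phi_eq_zero, fun h => ?_⟩
  simp [phi, h.1, h.2]

theorem pow_card_ne (hβ : IsNormalBasis F β) : β ^ Fintype.card F ≠ β := fun h => by
  have := LinearIndependent.pair_iff.1 hβ.1 1 (-1) (by rw [h]; simp)
  exact one_ne_zero this.1

theorem pow_card_ne_neg (hβ : IsNormalBasis F β) : β ^ Fintype.card F ≠ -β := fun h => by
  have := LinearIndependent.pair_iff.1 hβ.1 1 1 (by rw [h]; simp)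
  exact one_ne_zero this.1

end IsNormalBasis

theorem pow_card_pow_card (hK : Module.finrank F K = 2) (x : K) :
    (x ^ Fintype.card F) ^ Fintype.card F = x := by
  have : Module.Finite F K := Module.finite_of_finrank_eq_succ hK
  have : Finite K := Module.finite_of_finite F
  have := Fintype.ofFinite K
  rw [← pow_mul, ← sq, ← hK, ← Module.card_eq_pow_finrank, FiniteField.pow_card]

theorem hermForm_pow_card (hK : Module.finrank F K = 2) (x y : ι → K) :
    hermForm F x y ^ Fintype.card F = hermForm F y x := by
  have h := map_sum (FiniteField.frobeniusAlgHom F K) (fun j => x j * y j ^ Fintype.card F)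
    Finset.univ
  simp only [FiniteField.frobeniusAlgHom_apply] at h
  rw [hermForm, h, hermForm]
  refine Finset.sum_congr rfl fun j _ => ?_
  rw [mul_pow, pow_card_pow_card hK, mul_comm]

omit [Field F] [Algebra F K] in
theorem hermForm_smul_right (t : K) (x y : ι → K) :
    hermForm F x (t • y) = t ^ Fintype.card F * hermForm F x y := by
  rw [hermForm, hermForm, Finset.mul_sum]
  refine Finset.sum_congr rfl fun j _ => ?_
  rw [Pi.smul_apply, smul_eq_mul, mul_pow]
  ring

/-- Conjugation interchanges `β` and `β^q`, so the terms with coefficient `β^(q+1)` are symmetric in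
`v` and `w` and cancel. -/
theorem hermForm_phi_sub (hK : Module.finrank F K = 2) (β : K) (v w : (ι → F) × (ι → F)) :
    hermForm F (phi F β v) (phi F β w) - hermForm F (phi F β w) (phi F β v) =
      (β ^ 2 - (β ^ Fintype.card F) ^ 2) * algebraMap F K (sympForm F ι v w) := by
  have hconj (s t : F) :
      (β * algebraMap F K s + β ^ Fintype.card F * algebraMap F K t) ^ Fintype.card F =
        β ^ Fintype.card F * algebraMap F K s + β * algebraMap F K t := by
    have h := map_add (FiniteField.frobeniusAlgHom F K) (β * algebraMap F K s)
      (β ^ Fintype.card F * algebraMap F K t)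
    simp only [FiniteField.frobeniusAlgHom_apply] at h
    rw [h, mul_pow, mul_pow, pow_card_pow_card hK, ← map_pow, ← map_pow, FiniteField.pow_card,
      FiniteField.pow_card]
  simp only [hermForm, phi, hconj, sympForm_apply, dotProduct, map_sub, map_sum, map_mul,
    ← Finset.sum_sub_distrib, Finset.mul_sum]
  refine Finset.sum_congr rfl fun j _ => ?_
  ring

omit [Field F] [Algebra F K] in
theorem mem_hermDual {D : Submodule K (ι → K)} {x : ι → K} :
    x ∈ hermDual F D ↔ ∀ y ∈ D, hermForm F x y = 0 := Iff.rfl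

/-- `φ` identifies the symplectic dual with the Hermitian dual. -/
theorem IsNormalBasis.phi_mem_hermDual_iff (hK : Module.finrank F K = 2) {β : K}
    (hβ : IsNormalBasis F β) {D : Submodule K (ι → K)} {v : (ι → F) × (ι → F)} :
    phi F β v ∈ hermDual F D ↔ ∀ w, phi F β w ∈ D → sympForm F ι w v = 0 := by
  have hne : β ^ 2 - (β ^ Fintype.card F) ^ 2 ≠ 0 := by
    rw [sq_sub_sq]
    refine mul_ne_zero (fun h => hβ.pow_card_ne_neg ?_) (fun h => hβ.pow_card_ne ?_)
    · linear_combination h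
    · linear_combination -h
  rw [mem_hermDual]
  constructor
  · intro h w hw
    have h1 := h _ hw
    have h2 := hermForm_phi_sub hK β w v
    rw [← hermForm_pow_card hK (phi F β v), h1, zero_pow Fintype.card_ne_zero, sub_zero] at h2
    simpa [hne] using h2.symm
  · intro h y hy
    -- The hypothesis only gives that the form equals its conjugate; `K`-linearity of `D` allows `y`
    -- to be replaced by `t • y`. Then `t = 1` and `t = β` together force the form to vanish, as
    -- `β^q ≠ β`.
    have key (t : K) : t ^ Fintype.card F * hermForm F (phi F β v) y =
        t * hermForm F (phi F β v) y ^ Fintype.card F := by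
      obtain ⟨w, hw⟩ := (hβ.phiEquiv ι).surjective (t • y)
      rw [hβ.phiEquiv_apply] at hw
      have h1 := hermForm_phi_sub hK β w v
      rw [h w (hw ▸ D.smul_mem t hy), map_zero, mul_zero, sub_eq_zero, hw, hermForm_smul_right,
        ← hermForm_pow_card hK (phi F β v), hermForm_smul_right, mul_pow,
        pow_card_pow_card hK] at h1
      exact h1.symm
    by_contra h0
    have h1 := key 1
    rw [one_pow, one_mul, one_mul] at h1
    have h2 := key β
    rw [← h1] at h2
    exact hβ.pow_card_ne (mul_right_cancel₀ h0 h2)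

/-- The preimage of a linear code under `φ`. -/
noncomputable def phiComap (β : K) (hβ : IsNormalBasis F β) (D : Submodule K (ι → K)) :
    Submodule F ((ι → F) × (ι → F)) :=
  (D.restrictScalars F).comap (hβ.phiEquiv ι).toLinearMap

omit [Fintype ι] in
theorem mem_phiComap {β : K} {hβ : IsNormalBasis F β} {D : Submodule K (ι → K)}
    {v : (ι → F) × (ι → F)} : v ∈ phiComap β hβ D ↔ phi F β v ∈ D := Iff.rfl

theorem finrank_phiComap (hK : Module.finrank F K = 2) {β : K} (hβ : IsNormalBasis F β)
    (D : Submodule K (ι → K)) :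
    Module.finrank F (phiComap β hβ D) = 2 * Module.finrank K D := by
  rw [← hK, Module.finrank_mul_finrank F K D]
  exact LinearEquiv.finrank_eq ((hβ.phiEquiv ι).ofSubmodule' (D.restrictScalars F))

theorem card_phiComap (hK : Module.finrank F K = 2) {β : K} (hβ : IsNormalBasis F β)
    (D : Submodule K (ι → K)) :
    Nat.card (phiComap β hβ D) = Fintype.card F ^ (2 * Module.finrank K D) := by
  rw [← finrank_phiComap hK hβ, Module.natCard_eq_pow_finrank (K := F), Nat.card_eq_fintype_card]

end Codes

/-! ### Entanglement-assisted codes from linear codes -/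

section EntanglementAssisted

variable {F : Type*} [Field F] [Fintype F] [DecidableEq F]

/-- The errors on Alice's qudits that are not detected are those in the symplectic dual of `C` that
are not in `C`. -/
theorem detects_aliceError_iff {n c : ℕ} {C : Submodule F ((Fin n → F) × (Fin n → F))}
    {f : C →ₗ[F] (Fin c → F) × (Fin c → F)} (hf : Function.Surjective f)
    (hfω : ∀ x y : C, sympForm F (Fin n) x y = sympForm F (Fin c) (f x) (f y))
    {T : Subgroup (Matrix.unitaryGroup (Fin n ⊕ Fin c → F) ℂ)} (hT : IsStabilizerGroup T)
    (hTC : pauliVectors T = LinearMap.range (extendBy f)) (v : (Fin n → F) × (Fin n → F)) :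
    ¬ Detects (fixedSpace T) (aliceError v) ↔
      (∀ w ∈ C, sympForm F (Fin n) w v = 0) ∧ v ∉ C := by
  have hsymp (x : C) : sympForm F _ (extendBy f x)
      (Sum.elim v.1 (0 : Fin c → F), Sum.elim v.2 (0 : Fin c → F)) = sympForm F (Fin n) x v := by
    have := sympForm_extendBy f x v 0
    simpa using this
  constructor
  · intro h
    have horth : ∀ w ∈ C, sympForm F (Fin n) w v = 0 := by
      intro w hw
      by_contra hne
      -- A nonzero form value may have trace zero; since `C` is an `F`-space, `w` can be rescaled to
      -- make the character nontrivial.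
      obtain ⟨t, ht⟩ := exists_traceChar_mul_ne_one hne
      refine h (detects_of_traceChar_ne_one (w := extendBy f (t • ⟨w, hw⟩))
        (hTC ▸ LinearMap.mem_range_self _ _) ?_)
      rw [hsymp]
      simpa [mul_comm] using ht
    refine ⟨horth, fun hv => h (detects_of_mem_pauliVectors ?_)⟩
    -- A vector of `C` orthogonal to `C` lies in the radical, which `f` kills; its extension is
    -- trivial on Bob's side and equals the error itself.
    have hfv : f ⟨v, hv⟩ = 0 := by
      apply eq_zero_of_forall_sympForm_eq_zero
      intro p
      obtain ⟨y, rfl⟩ := hf p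
      rw [← hfω, ← sympForm_isAlt.neg, horth y y.2, neg_zero]
    rw [hTC]
    exact ⟨⟨v, hv⟩, by simp [extendBy, hfv]⟩
  · rintro ⟨horth, hv⟩
    refine hT.not_detects ?_ ?_
    · rw [hTC]
      rintro ⟨x, hx⟩
      apply hv
      have h1 : x.1 = v := Prod.ext
        (funext fun i => congrFun (congrArg Prod.fst hx) (Sum.inl i))
        (funext fun i => congrFun (congrArg Prod.snd hx) (Sum.inl i))
      exact h1 ▸ x.2
    · rw [hTC]
      rintro _ ⟨x, rfl⟩
      rw [hsymp, horth x x.2]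

/-- As `f` is surjective, Bob's parts fill all of `F^{2c}`, where the symplectic form is
nondegenerate. -/
theorem exists_traceChar_sympForm_ne_one {n c : ℕ}
    {C : Submodule F ((Fin n → F) × (Fin n → F))}
    {f : C →ₗ[F] (Fin c → F) × (Fin c → F)} (hf : Function.Surjective f)
    {p : (Fin c → F) × (Fin c → F)} (hp : p ≠ 0) :
    ∃ w ∈ LinearMap.range (extendBy f), traceChar F (sympForm F _ w
      (Sum.elim (0 : Fin n → F) p.1, Sum.elim (0 : Fin n → F) p.2)) ≠ 1 := by
  obtain ⟨s, hs⟩ : ∃ s, sympForm F (Fin c) p s ≠ 0 := by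
    by_contra! h
    exact hp (eq_zero_of_forall_sympForm_eq_zero h)
  rw [← sympForm_isAlt.neg, neg_ne_zero] at hs
  obtain ⟨t, ht⟩ := exists_traceChar_mul_ne_one hs
  obtain ⟨x, hx⟩ := hf (t • s).swap
  refine ⟨_, LinearMap.mem_range_self _ x, ?_⟩
  have h := sympForm_extendBy f x 0 p
  rw [map_zero, zero_add, hx, Prod.swap_swap] at h
  rw [Prod.fst_zero, Prod.snd_zero] at h
  rw [h, map_smul, LinearMap.smul_apply, smul_eq_mul, mul_comm]
  exact ht

omit [Fintype F] [DecidableEq F] in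
theorem bijOn_alicePart_extendBy {n c : ℕ} {C : Submodule F ((Fin n → F) × (Fin n → F))}
    (f : C →ₗ[F] (Fin c → F) × (Fin c → F)) :
    Set.BijOn alicePart (LinearMap.range (extendBy f) : Set ((Fin n ⊕ Fin c → F) × _))
      (C : Set ((Fin n → F) × (Fin n → F))) := by
  have h (x : C) : alicePart (extendBy f x) = x := rfl
  refine ⟨?_, ?_, fun v hv => ⟨_, LinearMap.mem_range_self _ ⟨v, hv⟩, h _⟩⟩
  · rintro _ ⟨x, rfl⟩
    exact x.2
  · rintro _ ⟨x, rfl⟩ _ ⟨y, rfl⟩ hxy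
    rw [h, h] at hxy
    rw [Subtype.ext hxy]

omit [Fintype F] [DecidableEq F] in
theorem card_range_extendBy {n c : ℕ} {C : Submodule F ((Fin n → F) × (Fin n → F))}
    (f : C →ₗ[F] (Fin c → F) × (Fin c → F)) :
    Nat.card (LinearMap.range (extendBy f) : Set ((Fin n ⊕ Fin c → F) × (Fin n ⊕ Fin c → F))) =
      Nat.card C :=
  Nat.card_congr (Set.BijOn.equiv alicePart (bijOn_alicePart_extendBy f))

/-- Divisibility of powers of `q` yields the bound on `s`, so the subtraction in the exponent is not
truncated. -/
theorem finrank_fixedSpace_eq {ι : Type*} [Fintype ι] [DecidableEq ι]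
    {T : Subgroup (Matrix.unitaryGroup (ι → F) ℂ)} (hT : IsStabilizerGroup T) {s : ℕ}
    (hs : Nat.card (pauliVectors T) = Fintype.card F ^ s) :
    s ≤ Fintype.card ι ∧
      Module.finrank ℂ (fixedSpace T) = Fintype.card F ^ (Fintype.card ι - s) := by
  have h := hT.finrank_fixedSpace_mul_card
  rw [hs] at h
  have hq : 1 < Fintype.card F := Fintype.one_lt_card
  have hle : s ≤ Fintype.card ι :=
    (Nat.pow_dvd_pow_iff_le_right hq).1 ⟨_, by rw [← h, mul_comm]⟩
  refine ⟨hle, Nat.eq_of_mul_eq_mul_right (pow_pos (Nat.zero_lt_of_lt hq) s) ?_⟩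
  rw [h, ← pow_add, Nat.sub_add_cancel hle]

theorem exists_isometry_into {m c k : ℕ} {Q : Submodule ℂ ((Fin m → F) → ℂ)}
    (hQ : Module.finrank ℂ Q = Fintype.card F ^ k) (hck : c ≤ k) :
    ∃ W : Matrix (Fin m → F) (Fin c → F) ℂ, Wᴴ * W = 1 ∧ ∀ x, W *ᵥ x ∈ Q := by
  obtain ⟨ψ, hψ, hon, -⟩ := exists_orthonormal_family (J := Fin c → F) Q (by
    simpa [hQ] using Nat.pow_le_pow_right Fintype.card_pos hck)
  refine ⟨Matrix.of fun y j => ψ j y, ?_, fun x => ?_⟩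
  · ext i j
    rw [Matrix.one_apply, ← hon]
    rfl
  · rw [Matrix.mulVec_eq_sum]
    refine Q.sum_mem fun j _ => ?_
    rw [op_smul_eq_smul]
    exact Q.smul_mem _ (hψ j)

variable {K : Type*} [Field K] [DecidableEq K] [Algebra F K]

omit [DecidableEq F] [DecidableEq K] in
/-- The symplectic form on `φ⁻¹(D)`, whose radical is the preimage of the Hermitian radical, has
`dim D - dim R_h(D)` pairs of hyperbolic coordinates. -/
theorem exists_hyperbolic_coordinates (hK : Module.finrank F K = 2) {β : K}
    (hβ : IsNormalBasis F β) {n c : ℕ} (D : Submodule K (Fin n → K))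
    (hc : c = Module.finrank K D - Module.finrank K (hermRadical F D)) :
    ∃ f : phiComap β hβ D →ₗ[F] (Fin c → F) × (Fin c → F), Function.Surjective f ∧
      ∀ x y : phiComap β hβ D, sympForm F (Fin n) x y = sympForm F (Fin c) (f x) (f y) := by
  obtain ⟨c', f, hf, hfω⟩ := exists_surjective_eq_sympForm
    ((sympForm F (Fin n)).domRestrict₁₂ (phiComap β hβ D) (phiComap β hβ D))
    fun x => sympForm_isAlt x.1
  -- By nondegeneracy of the target form the kernel of `f` is the radical of `φ⁻¹(D)`. Rank-nullity
  -- then reads `2c' + 2r = 2u`.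
  have hker : (LinearMap.ker f).map (phiComap β hβ D).subtype =
      phiComap β hβ (hermRadical F D) := by
    ext v
    have hv (hv : v ∈ phiComap β hβ D) :
        f ⟨v, hv⟩ = 0 ↔ phi F β v ∈ hermDual F D := by
      rw [hβ.phi_mem_hermDual_iff hK]
      constructor
      · intro h w hw
        have := hfω ⟨w, hw⟩ ⟨v, hv⟩
        rw [h, map_zero] at this
        exact this
      · intro h
        apply eq_zero_of_forall_sympForm_eq_zero
        intro p
        obtain ⟨y, rfl⟩ := hf p
        rw [← sympForm_isAlt.neg, ← hfω, neg_eq_zero]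
        exact h y y.2
    constructor
    · rintro ⟨x, hx, rfl⟩
      exact ⟨x.2, (hv x.2).1 hx⟩
    · rintro ⟨h1, h2⟩
      exact ⟨⟨v, h1⟩, (hv h1).2 h2, rfl⟩
  have h1 := f.finrank_range_add_finrank_ker
  rw [LinearMap.range_eq_top.2 hf, finrank_top, ← Submodule.finrank_map_subtype_eq, hker,
    finrank_phiComap hK, finrank_phiComap hK, Module.finrank_prod, Module.finrank_fin_fun] at h1
  obtain rfl : c = c' := by omega
  exact ⟨f, hf, hfω⟩

theorem eaDistance_eq_minWeight (hK : Module.finrank F K = 2) {β : K}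
    (hβ : IsNormalBasis F β) {n c : ℕ} (D : Submodule K (Fin n → K))
    {f : phiComap β hβ D →ₗ[F] (Fin c → F) × (Fin c → F)} (hf : Function.Surjective f)
    (hfω : ∀ x y : phiComap β hβ D, sympForm F (Fin n) x y = sympForm F (Fin c) (f x) (f y))
    {T : Subgroup (Matrix.unitaryGroup (Fin n ⊕ Fin c → F) ℂ)} (hT : IsStabilizerGroup T)
    (hTC : pauliVectors T = LinearMap.range (extendBy f)) :
    eaDistance (fixedSpace T) =
      minWeight ((hermDual F D : Set (Fin n → K)) \ hermRadical F D) := by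
  rw [eaDistance, minWeight, ← (hβ.phiEquiv (Fin n)).toEquiv.iInf_comp]
  refine iInf_congr fun v => iInf_congr_Prop ?_ fun _ => ?_
  · rw [detects_aliceError_iff hf hfω hT hTC]
    have h := hβ.phi_mem_hermDual_iff hK (D := D) (v := v)
    change _ ↔ phi F β v ∈ hermDual F D ∧ ¬ (phi F β v ∈ D ∧ phi F β v ∈ hermDual F D)
    rw [← mem_phiComap (hβ := hβ) (D := D), h]
    simp only [mem_phiComap]
    tauto
  · exact congrArg _ (hβ.hammingNorm_phi v).symm

end EntanglementAssisted

end EAQ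

theorem mainTheorem5 {F K : Type*} [Field F] [Fintype F] [DecidableEq F] [Field K] [DecidableEq K]
    [Algebra F K] (hK : Module.finrank F K = 2)
    (n u r m v c : ℕ)
    (D De : Submodule K (Fin n → K)) (hu : Module.finrank K D = u)
    (hsup : EAQ.hermRadical F D ⊔ De = D) (hdisj : Disjoint (EAQ.hermRadical F D) De)
    (hDe : EAQ.IsHermLCD F De) (hr : Module.finrank K (EAQ.hermRadical F D) = r)
    (Db : Submodule K (Fin m → K)) (hv : Module.finrank K Db = v)
    (hDb : EAQ.IsHermSelfOrthogonal F Db)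
    (hc : c = u - r) (hcm : c ≤ m - 2 * v) :
    (∃ β : K, EAQ.IsNormalBasis F β) ∧
    ∀ β : K, EAQ.IsNormalBasis F β →
      ∃ (S : Subgroup (Matrix.unitaryGroup (Fin n → F) ℂ))
        (Sb : Subgroup (Matrix.unitaryGroup (Fin m → F) ℂ))
        (Qea : Submodule ℂ ((Fin n ⊕ Fin c → F) → ℂ)) (Qb : Submodule ℂ ((Fin m → F) → ℂ)),
        EAQ.pauliVectors S = {w | EAQ.phi F β w ∈ D} ∧
        EAQ.pauliVectors Sb = {w | EAQ.phi F β w ∈ Db} ∧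
        EAQ.IsCombination S Sb (n - c - 2 * r)
          (EAQ.minWeight ((EAQ.hermDual F D : Set (Fin n → K)) \ EAQ.hermRadical F D))
          (m - 2 * v) Qea Qb := by
  refine ⟨EAQ.exists_isNormalBasis hK, fun β hβ => ?_⟩
  have hru : r ≤ u := by
    rw [← hr, ← hu]
    exact Submodule.finrank_mono inf_le_left
  obtain ⟨f, hf, hfω⟩ := EAQ.exists_hyperbolic_coordinates hK hβ D (c := c) (by rw [hc, hu, hr])
  obtain ⟨T, hT, hTC⟩ := EAQ.exists_isStabilizerGroup (C := LinearMap.range (EAQ.extendBy f)) (by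
    rintro _ ⟨x, rfl⟩ _ ⟨y, rfl⟩
    have h := EAQ.sympForm_extendBy f x y (f y).swap
    rw [EAQ.sympForm_swap_swap, hfω, add_neg_cancel] at h
    exact h)
  obtain ⟨Sb, hSb, hSbC⟩ := EAQ.exists_isStabilizerGroup (C := EAQ.phiComap β hβ Db) (by
    intro v hv w hw
    exact (hβ.phi_mem_hermDual_iff hK (D := Db)).1 (hDb hw) v hv)
  have hTcard : Nat.card (EAQ.pauliVectors T) = Fintype.card F ^ (2 * u) := by
    rw [← hu, ← EAQ.card_phiComap hK hβ D, hTC,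
      EAQ.card_range_extendBy]
  have hSbcard : Nat.card (EAQ.pauliVectors Sb) = Fintype.card F ^ (2 * v) := by
    rw [← hv, ← EAQ.card_phiComap hK hβ Db, hSbC]
    rfl
  obtain ⟨hun, hTdim⟩ := EAQ.finrank_fixedSpace_eq hT hTcard
  obtain ⟨-, hSbdim⟩ := EAQ.finrank_fixedSpace_eq hSb hSbcard
  rw [Fintype.card_sum, Fintype.card_fin, Fintype.card_fin] at hun hTdim
  rw [Fintype.card_fin] at hSbdim
  -- Here `u = c + r`, because `r ≤ u`.
  rw [show n + c - 2 * u = n - c - 2 * r by omega] at hTdim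
  refine ⟨EAQ.pauliSubgroup (EAQ.phiComap β hβ D), Sb, EAQ.fixedSpace T, EAQ.fixedSpace Sb,
    EAQ.pauliVectors_pauliSubgroup _, hSbC, ⟨EAQ.pauliSubgroup_le _, ⟨T, hT, ?_, rfl⟩,
      EAQ.exists_eaEncoder (fun a b hab => ?_) hTdim,
      EAQ.eaDistance_eq_minWeight hK hβ D hf hfω hT hTC⟩,
    ⟨hSb, rfl, hSbdim⟩, hcm, EAQ.exists_isometry_into hSbdim hcm⟩
  · rw [EAQ.IsExtension, hTC, EAQ.pauliVectors_pauliSubgroup]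
    exact EAQ.bijOn_alicePart_extendBy f
  · obtain ⟨w, hw, hne⟩ := EAQ.exists_traceChar_sympForm_ne_one hf hab
    exact ⟨w, hTC.symm.subset hw, hne⟩
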